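/- Let $(\lambda_n)_{n\ge 1}$ be a strictly increasing sequence of real numbers with $\lambda_n\ge 1$ and $$\lambda_n^2=n+a\sqrt n\,\log^b n+o(1),\qquad n\to\infty,$$ for some constants $a>0$ and $b>3/2$. Let $\theta_1,\theta_2,\dots$ be independent random variables, each uniformly distributed on $[0,2\pi]$, and let $\mathcal N=\{z_n\}_{n\ge1}$, $z_n=\lambda_n e^{i\theta_n}$. For $0<p<\infty$ the classical Fock space $\mathcal F^p$ consists of the entire functions $f$ with $\int_{\mathbb C}|f(z)|^p e^{-p|z|^2/2}\,dm(z)<\infty$, where $m$ is Lebesgue measure on $\mathbb C$. Then, almost surely, for every $p>0$ the sequence $\mathcal N$ is a zero set of $\mathcal F^p$: there is a nonzero $f\in\mathcal F^p$ whose zeros, counted with multiplicity, are exactly the points $z_n$. Moreover $\mathcal N$ always has critical density with respect to $\mathcal F^p$: if $n(t)$ denotes the number of indices $n$ with $|z_n|<t$, then $n(t)$ is finite for every $t$ and $n(t)/t^2\to1$ as $t\to\infty$. For all $a>0$ and $b>3/2$ sequences $(\lambda_n)$ with these properties exist, so there are random sequences of critical density that are almost surely zero sets of every $\mathcal F^p$.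 -/

import Mathlib

open MeasureTheory ProbabilityTheory Filter Topology Asymptotics

/-- The Fock type space with weight `φ` and exponent `p`: the entire functions `f` such that
`|f(z)| ^ p * exp (-p * φ |z|)` is integrable with respect to Lebesgue measure on `ℂ`. -/
def FockSpace (φ : ℝ → ℝ) (p : ℝ) : Set (ℂ → ℂ) :=
  {f | Differentiable ℂ f ∧
    Integrable (fun z : ℂ => ‖f z‖ ^ p * Real.exp (-p * φ ‖z‖)) volume}

/-- The weight `φ(r) = r ^ 2 / 2` of the classical Fock spaces. -/
noncomputable def classicalWeight (r : ℝ) : ℝ := r ^ 2 / 2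

/-- The sequence `z` is a zero set of the function space `F`: some nonzero `f` in `F` vanishes
exactly at the points of `z`, each zero having as multiplicity the number of times that the point
occurs in the sequence. -/
def IsZeroSet {ι : Type*} (F : Set (ℂ → ℂ)) (z : ι → ℂ) : Prop :=
  ∃ f ∈ F, f ≠ 0 ∧ ∀ w : ℂ, analyticOrderAt f w = {n : ι | z n = w}.encard

/-- The randomization `z_n = lam_n * exp (i θ_n)` of the sequence `lam`, `n = 1, 2, 3, …`. -/
noncomputable def randomization {Ω : Type*} (lam : ℕ+ → ℝ) (θ : ℕ+ → Ω → ℝ) (ω : Ω) (n : ℕ+) : ℂ :=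
  (lam n : ℂ) * Complex.exp (Complex.I * (θ n ω : ℂ))

/-- The number of elements of the sequence `z` in the open disk of radius `t` about `0`. -/
noncomputable def countingFunction {ι : Type*} (z : ι → ℂ) (t : ℝ) : ℕ :=
  {n : ι | ‖z n‖ < t}.ncard

/-- The sequence `z` is of critical density with respect to the weight `φ`: every disk contains
only finitely many of its elements, and `n(t) / (t * φ'(t))` tends to `1`. -/
def IsCriticalDensity {ι : Type*} (φ : ℝ → ℝ) (z : ι → ℂ) : Prop :=
  (∀ t : ℝ, {n : ι | ‖z n‖ < t}.Finite) ∧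
    Tendsto (fun t : ℝ => (countingFunction z t : ℝ) / (t * deriv φ t)) atTop (𝓝 1)

/-- The conditions on the moduli: `lam` is strictly increasing, `lam n ≥ 1`, and
`lam n ^ 2 = n + a * √n * (log n) ^ b + o(1)` as `n → ∞`. -/
structure ModuliCondition (a b : ℝ) (lam : ℕ+ → ℝ) : Prop where
  strictMono : StrictMono lam
  one_le : ∀ n, 1 ≤ lam n
  asymptotics :
    (fun n : ℕ+ => lam n ^ 2 -
      (((n : ℕ) : ℝ) + a * √((n : ℕ) : ℝ) * Real.log ((n : ℕ) : ℝ) ^ b))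
      =o[atTop] (fun _ : ℕ+ => (1 : ℝ))

/-! The function is f(x) = exp(-C x²/2) ∏ E(x/z_i) with E(w) = (1 - w) exp(w + w²/2), where C is the
almost sure limit of ∑ 1/z_i² along the partial sums over i < j¹². For |x| ≤ j it equals the
polynomial ∏_{i<j¹²} (1 - x/z_i) times the exponential of x ∑_{i<j¹²} 1/z_i - (x²/2)(C - ∑_{i<j¹²}
1/z_i²) plus a tail of logarithms of E.

The gain is deterministic. The mean of log|1 - x/z_i| over the angle is log⁺(|x|/r_i), and if r_i²
were i + 1 these means would sum to at most t²/2 at |x| = t, because x^N/N! ≤ e^x. The extra term a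
√n log^b n, with b > 1, lowers the sum by more than K t log t for every K
(`eventually_sum_posLog_le`).

The random losses are only O(j log j). The moments of order s = 1/j of |ζ - a|
(`circleAverage_norm_sub_rpow_le`) and independence bound the polynomial at each vertex of a regular
polygon on |x| = j, and hence on the disk (`ae_eventually_norm_prod_le`). Chernoff bounds give
∑_{i<j¹²} 1/z_i = O(log j) and C - ∑_{i<j¹²} 1/z_i² = O(1/j). The tail is bounded because ∑_{i≥j¹²}
(j/r_i)³ is. Borel–Cantelli makes all this hold for all large j, so |f(x)| ≤ exp(|x|²/2 - |x|) for
large |x| (`ae_exists_norm_canonicalProduct_le`). A single f therefore serves every p > 0. -/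

/-! ### Small moments of the distance to a point on the unit circle -/

theorem exp_le_one_add_add_sq {y : ℝ} (hy : y ≤ 1) : Real.exp y ≤ 1 + y + y ^ 2 := by
  rcases le_or_gt (-1) y with h | h
  · have := Real.abs_exp_sub_one_sub_id_le (abs_le.2 ⟨h, hy⟩)
    linarith [le_abs_self (Real.exp y - 1 - y)]
  · have : Real.exp y ≤ 1 := Real.exp_le_one_iff.2 (by linarith)
    nlinarith

theorem log_sq_le_rpow {t : ℝ} (h0 : 0 < t) (h1 : t ≤ 1) :
    Real.log t ^ 2 ≤ 16 * t ^ (-(1 / 2) : ℝ) := by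
  have h := Real.log_le_rpow_div (x := t⁻¹) (ε := 1 / 4) (by positivity) (by norm_num)
  rw [Real.log_inv, Real.inv_rpow h0.le, ← Real.rpow_neg h0.le] at h
  have hl : Real.log t ≤ 0 := Real.log_nonpos h0.le h1
  have h2 : (t ^ (-(1 / 4) : ℝ)) ^ 2 = t ^ (-(1 / 2) : ℝ) := by
    rw [← Real.rpow_natCast, ← Real.rpow_mul h0.le]; norm_num
  rw [← h2]
  have : 0 ≤ t ^ (-(1 / 4) : ℝ) := by positivity
  nlinarith

/-- The square of the logarithm of `|1 - u e ^ {iθ}|`, bounded by an integrable function of `θ`. -/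
theorem sq_log_chord_le {u θ : ℝ} (hu0 : 0 ≤ u) (hu1 : u ≤ 1) (hθ : |θ| ≤ Real.pi) (h0 : θ ≠ 0) :
    (Real.log (1 + u ^ 2 - 2 * u * Real.cos θ) / 2) ^ 2
      ≤ 64 * u ^ 2 * (1 + |θ / Real.pi| ^ (-(1 / 2) : ℝ)) := by
  have hπ := Real.pi_pos
  set d := 1 + u ^ 2 - 2 * u * Real.cos θ with hd
  have hq := Real.cos_le_one_sub_mul_cos_sq hθ
  have hc1 := Real.neg_one_le_cos θ
  have hc2 := Real.cos_le_one θ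
  have hp : 0 ≤ |θ / Real.pi| ^ (-(1 / 2) : ℝ) := by positivity
  rcases le_or_gt u (1 / 2) with h | h
  · have hd1 : (1 - u) ^ 2 ≤ d := by rw [hd]; nlinarith
    have hd2 : d ≤ (1 + u) ^ 2 := by rw [hd]; nlinarith
    have hdp : 0 < d := lt_of_lt_of_le (by nlinarith) hd1
    have hl1 : Real.log d ≤ 2 * u := by
      have := Real.log_le_log hdp hd2
      rw [Real.log_pow] at this
      have := Real.log_le_sub_one_of_pos (show 0 < 1 + u by linarith)
      push_cast at *; linarith
    have hl2 : -(4 * u) ≤ Real.log d := by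
      have h1 := Real.log_le_log (by nlinarith) hd1
      rw [Real.log_pow] at h1
      have h2 := Real.one_sub_inv_le_log_of_pos (show 0 < 1 - u by linarith)
      have h3 : (1 - u)⁻¹ ≤ 1 + 2 * u := by
        rw [inv_le_iff_one_le_mul₀ (by linarith)]; nlinarith
      push_cast at *; linarith
    have : (Real.log d / 2) ^ 2 ≤ 4 * u ^ 2 := by nlinarith
    nlinarith [sq_nonneg u, mul_nonneg (sq_nonneg u) hp]
  -- Here d = (1 - u)² + 2u(1 - cos θ) ≥ τ², so the singularity at θ = 0 is at most that of log² τ ≤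
  -- 16 τ^(-1/2), and 64 u² ≥ 16.
  · set τ := |θ / Real.pi| with hτ
    have hτ0 : 0 < τ := abs_pos.2 (div_ne_zero h0 hπ.ne')
    have hτ1 : τ ≤ 1 := by
      rw [hτ, abs_div, abs_of_pos hπ]; exact (div_le_one hπ).2 hθ
    have hd1 : τ ^ 2 ≤ d := by
      have : τ ^ 2 = θ ^ 2 / Real.pi ^ 2 := by rw [hτ, sq_abs, div_pow]
      have h2 : Real.cos θ ≤ 1 - 2 * τ ^ 2 := by
        rw [this]; calc _ ≤ _ := hq
          _ = _ := by ring
      rw [hd]; nlinarith [sq_nonneg (1 - u), sq_nonneg τ]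
    have hd2 : d ≤ 4 := by rw [hd]; nlinarith
    have hdp : 0 < d := lt_of_lt_of_le (by positivity) hd1
    have hl1 : Real.log d ≤ 2 := by
      have := Real.log_le_log hdp hd2
      have h4 : Real.log 4 = 2 * Real.log 2 := by
        rw [show (4 : ℝ) = 2 ^ 2 by norm_num, Real.log_pow]; norm_num
      linarith [Real.log_two_lt_d9]
    have hl2 : 2 * Real.log τ ≤ Real.log d := by
      have := Real.log_le_log (by positivity) hd1
      rwa [Real.log_pow] at this
    have hτl : Real.log τ ≤ 0 := Real.log_nonpos hτ0.le hτ1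
    have hs := log_sq_le_rpow hτ0 hτ1
    have : (Real.log d / 2) ^ 2 ≤ 1 + Real.log τ ^ 2 := by
      rcases le_total 0 (Real.log d) with h | h <;> nlinarith [sq_nonneg (Real.log τ)]
    nlinarith [mul_nonneg (show 0 ≤ u ^ 2 - 1 / 4 by nlinarith)
      (show 0 ≤ 1 + τ ^ (-(1 / 2) : ℝ) by linarith)]

theorem sq_norm_circleMap_sub (a : ℂ) (θ : ℝ) :
    ‖circleMap 0 1 θ - a‖ ^ 2 = 1 + ‖a‖ ^ 2 - 2 * ‖a‖ * Real.cos (θ - a.arg) := by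
  have h1 : a.re = ‖a‖ * Real.cos a.arg := (Complex.norm_mul_cos_arg a).symm
  have h2 : a.im = ‖a‖ * Real.sin a.arg := (Complex.norm_mul_sin_arg a).symm
  have hz : circleMap 0 1 θ = (Real.cos θ : ℂ) + (Real.sin θ : ℂ) * Complex.I := by
    simp [circleMap, Complex.exp_mul_I]
  rw [hz, Complex.sq_norm, Complex.normSq_apply]
  simp only [Complex.sub_re, Complex.add_re, Complex.ofReal_re, Complex.mul_re, Complex.I_re,
    Complex.sub_im, Complex.add_im, Complex.ofReal_im, Complex.mul_im, Complex.I_im]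
  rw [h1, h2, Real.cos_sub]
  have e1 := Real.sin_sq_add_cos_sq θ
  have e2 := Real.sin_sq_add_cos_sq a.arg
  linear_combination e1 + ‖a‖ ^ 2 * e2

/-- For ‖a‖ > 1, dividing by ‖a‖ turns the difference into the logarithm of a chord with u = 1/‖a‖.
This is the other case again, and u ≤ 1 < ‖a‖ keeps the factor ‖a‖². -/
theorem log_norm_circleMap_sub_sq_le (a : ℂ) {θ : ℝ} (hθ : |θ - a.arg| ≤ Real.pi)
    (h0 : θ ≠ a.arg) :
    (Real.log ‖circleMap 0 1 θ - a‖ - Real.posLog ‖a‖) ^ 2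
      ≤ 64 * ‖a‖ ^ 2 * (1 + |(θ - a.arg) / Real.pi| ^ (-(1 / 2) : ℝ)) := by
  have hlog : Real.log ‖circleMap 0 1 θ - a‖
      = Real.log (1 + ‖a‖ ^ 2 - 2 * ‖a‖ * Real.cos (θ - a.arg)) / 2 := by
    rw [← sq_norm_circleMap_sub, Real.log_pow]; push_cast; ring
  rcases le_or_gt ‖a‖ 1 with h | h
  · rw [(Real.posLog_eq_zero_iff _).2 (by rwa [abs_norm]), sub_zero, hlog]
    exact sq_log_chord_le (norm_nonneg a) h hθ (sub_ne_zero.2 h0)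
  · have ha : 0 < ‖a‖ := by linarith
    have hne : circleMap 0 1 θ - a ≠ 0 := by
      intro hc
      have : ‖circleMap 0 1 θ‖ = ‖a‖ := by rw [sub_eq_zero.1 hc]
      rw [norm_circleMap_zero, abs_one] at this
      linarith
    have hpos : 0 < ‖circleMap 0 1 θ - a‖ ^ 2 := by positivity
    rw [sq_norm_circleMap_sub] at hpos
    rw [Real.posLog_eq_log (by rw [abs_norm]; exact h.le), hlog]
    have : Real.log (1 + ‖a‖ ^ 2 - 2 * ‖a‖ * Real.cos (θ - a.arg)) / 2 - Real.log ‖a‖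
        = Real.log (1 + ‖a‖⁻¹ ^ 2 - 2 * ‖a‖⁻¹ * Real.cos (θ - a.arg)) / 2 := by
      have e : 1 + ‖a‖⁻¹ ^ 2 - 2 * ‖a‖⁻¹ * Real.cos (θ - a.arg)
        = (1 + ‖a‖ ^ 2 - 2 * ‖a‖ * Real.cos (θ - a.arg)) / ‖a‖ ^ 2 := by field_simp; ring
      rw [e, Real.log_div hpos.ne' (by positivity), Real.log_pow]; push_cast; ring
    rw [this]
    have hi : ‖a‖⁻¹ ≤ 1 := inv_le_one_of_one_le₀ h.le
    refine (sq_log_chord_le (by positivity) hi hθ (sub_ne_zero.2 h0)).trans ?_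
    gcongr
    linarith

theorem intervalIntegrable_abs_div_pi_rpow :
    IntervalIntegrable (fun θ : ℝ => |θ / Real.pi| ^ (-(1 / 2) : ℝ)) volume (-Real.pi) Real.pi := by
  have hπ := Real.pi_pos
  have h : IntervalIntegrable (fun θ : ℝ => |θ / Real.pi| ^ (-(1 / 2) : ℝ)) volume 0 Real.pi := by
    have h1 := (intervalIntegral.intervalIntegrable_rpow' (a := 0) (b := Real.pi)
      (r := -(1 / 2)) (by norm_num)).const_mul (Real.pi ^ (1 / 2 : ℝ))
    refine h1.congr ?_
    intro x hx
    rw [Set.uIoc_of_le hπ.le] at hx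
    have hx0 := hx.1
    simp only
    rw [abs_of_pos (by positivity), Real.div_rpow hx0.le hπ.le, Real.rpow_neg hπ.le]
    field_simp
  refine IntervalIntegrable.trans (b := 0) ?_ h
  have := h.comp_sub_left 0
  simp only [zero_sub, sub_zero, neg_div, abs_neg] at this
  exact this.symm

/-- Expand |ζ - a|^s = e^(sm) e^(sX), where m = log⁺|a| and X = log|ζ - a| - m. By Jensen's formula
X has mean zero, so the linear term drops out and only the second moment of X, of order |a|²,
remains. -/
theorem circleAverage_norm_sub_rpow_le :
    ∃ C : ℝ, 0 < C ∧ ∀ (a : ℂ) (s : ℝ), 0 < s → s ≤ 1 →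
      Real.circleAverage (fun ζ => ‖ζ - a‖ ^ s) 0 1
        ≤ Real.exp (s * Real.posLog ‖a‖ + C * s ^ 2 * ‖a‖ ^ 2) := by
  have hπ := Real.pi_pos
  set g : ℝ → ℝ := fun θ => |θ / Real.pi| ^ (-(1 / 2) : ℝ) with hg
  have hg0 : ∀ θ, 0 ≤ g θ := fun θ => by positivity
  set K := ∫ θ in (-Real.pi)..Real.pi, g θ with hK
  have hK0 : 0 ≤ K := intervalIntegral.integral_nonneg (by linarith) fun θ _ => hg0 θ
  refine ⟨64 * (1 + K / (2 * Real.pi)), by positivity, fun a s hs0 hs1 => ?_⟩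
  set m := Real.posLog ‖a‖ with hm
  have hm0 : 0 ≤ m := Real.posLog_nonneg
  set φ := a.arg
  -- Periodicity moves the integral to the window of length 2π centred at arg a, where |θ - arg a| ≤
  -- π.
  have hper : Function.Periodic (fun θ => ‖circleMap 0 1 θ - a‖ ^ s) (2 * Real.pi) := fun θ => by
    simp only [periodic_circleMap 0 1 θ]
  have hper2 : Function.Periodic (fun θ => Real.log ‖circleMap 0 1 θ - a‖) (2 * Real.pi) :=
    fun θ => by simp only [periodic_circleMap 0 1 θ]
  have hshift : φ - Real.pi + 2 * Real.pi = φ + Real.pi := by ring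
  have hle : φ - Real.pi ≤ φ + Real.pi := by linarith
  have hlog : ∫ θ in (φ - Real.pi)..(φ + Real.pi), Real.log ‖circleMap 0 1 θ - a‖
      = 2 * Real.pi * m := by
    have h1 := circleAverage_log_norm_sub_const_eq_posLog (a := a)
    rw [Real.circleAverage_def] at h1
    have h2 := hper2.intervalIntegral_add_eq (φ - Real.pi) 0
    rw [hshift, zero_add] at h2
    rw [h2, hm, ← h1, smul_eq_mul]
    field_simp
  have hilog : IntervalIntegrable (fun θ => Real.log ‖circleMap 0 1 θ - a‖) volume
      (φ - Real.pi) (φ + Real.pi) := by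
    have h1 : CircleIntegrable (fun z => Real.log ‖z - a‖) 0 1 :=
      circleIntegrable_log_norm_sub_const 1
    have h1 : IntervalIntegrable (fun θ => Real.log ‖circleMap 0 1 θ - a‖) volume 0 (2 * Real.pi) :=
      h1
    have := hper2.intervalIntegrable (t := 0) (by positivity) (by simpa using h1)
      (φ - Real.pi) (φ + Real.pi)
    exact this
  have hig : IntervalIntegrable (fun θ => g (θ - φ)) volume (φ - Real.pi) (φ + Real.pi) := by
    have := intervalIntegrable_abs_div_pi_rpow.comp_sub_right φ
    rw [show -Real.pi + φ = φ - Real.pi by ring, show Real.pi + φ = φ + Real.pi by ring] at this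
    exact this
  have hgK : ∫ θ in (φ - Real.pi)..(φ + Real.pi), g (θ - φ) = K := by
    rw [intervalIntegral.integral_comp_sub_right (fun θ => g θ) φ, hK]
    congr 1 <;> ring
  have hint : ∫ θ in (0 : ℝ)..2 * Real.pi, ‖circleMap 0 1 θ - a‖ ^ s
      ≤ Real.exp (s * m) * (2 * Real.pi + s ^ 2 * (64 * ‖a‖ ^ 2) * (2 * Real.pi + K)) := by
    have h2 := hper.intervalIntegral_add_eq (φ - Real.pi) 0
    rw [hshift, zero_add] at h2
    rw [← h2]
    have hi1 : IntervalIntegrable (fun θ => s * (Real.log ‖circleMap 0 1 θ - a‖ - m)) volume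
      (φ - Real.pi) (φ + Real.pi) := (hilog.sub intervalIntegrable_const).const_mul s
    have hi2 : IntervalIntegrable (fun θ => s ^ 2 * (64 * ‖a‖ ^ 2) * (1 + g (θ - φ))) volume
      (φ - Real.pi) (φ + Real.pi) := (intervalIntegrable_const.add hig).const_mul _
    have hi3 : IntervalIntegrable (fun _ => (1 : ℝ)) volume
      (φ - Real.pi) (φ + Real.pi) := intervalIntegrable_const
    calc _ ≤ ∫ θ in (φ - Real.pi)..(φ + Real.pi), Real.exp (s * m) *
          (1 + s * (Real.log ‖circleMap 0 1 θ - a‖ - m)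
            + s ^ 2 * (64 * ‖a‖ ^ 2) * (1 + g (θ - φ))) := by
          refine intervalIntegral.integral_mono_ae_restrict hle ?_
            (((hi3.add hi1).add hi2).const_mul _) ?_
          · refine Continuous.intervalIntegrable ?_ _ _
            exact (((continuous_circleMap 0 1).sub continuous_const).norm).rpow_const
              fun _ => Or.inr hs0.le
          · have hae : ∀ᵐ θ ∂(volume.restrict (Set.Icc (φ - Real.pi) (φ + Real.pi))), θ ≠ φ :=
              ae_restrict_of_ae (Measure.ae_ne volume φ)
            filter_upwards [hae, ae_restrict_mem measurableSet_Icc] with θ h1 h2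
            have hsq := log_norm_circleMap_sub_sq_le a (θ := θ)
              (abs_le.2 ⟨by linarith [h2.1], by linarith [h2.2]⟩) h1
            have hg1 : g (θ - φ) = |(θ - a.arg) / Real.pi| ^ (-(1 / 2) : ℝ) := rfl
            rw [← hg1, ← hm] at hsq
            set X := Real.log ‖circleMap 0 1 θ - a‖ - m with hX
            have hs2 : (s * X) ^ 2 ≤ s ^ 2 * (64 * ‖a‖ ^ 2) * (1 + g (θ - φ)) := by
              have := mul_le_mul_of_nonneg_left hsq (sq_nonneg s)
              calc (s * X) ^ 2 = s ^ 2 * X ^ 2 := by ring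
                _ ≤ _ := this
                _ = _ := by ring
            -- Since `Real.log 0 = 0`, the exponential form of the power fails at ζ = a. There the
            -- left side is 0^s = 0.
            rcases eq_or_ne (circleMap 0 1 θ) a with hz | hz
            · have ha1 : ‖a‖ = 1 := by rw [← hz]; simp
              have hm1 : m = 0 := by rw [hm, ha1]; simp
              have hX0 : X = 0 := by rw [hX, hz, hm1]; simp
              have hg2 := hg0 (θ - φ)
              simp only [hz, sub_self, norm_zero, Real.zero_rpow hs0.ne', hX0, mul_zero, add_zero]
              positivity
            · have hn : 0 < ‖circleMap 0 1 θ - a‖ := norm_pos_iff.2 (sub_ne_zero.2 hz)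
              -- X is not bounded below uniformly in θ and a, but the quadratic bound for exp needs
              -- only an upper bound, and log(1 + |a|) ≤ log 2 + log⁺|a|.
              have hX1 : X ≤ 1 := by
                have h3 : ‖circleMap 0 1 θ - a‖ ≤ 1 + ‖a‖ := by
                  refine (norm_sub_le _ _).trans ?_
                  simp
                have h4 := (Real.log_le_log hn h3).trans
                  ((le_max_right 0 _).trans ((Real.posLog_apply).symm.le.trans Real.posLog_add))
                have h5 : Real.posLog (1 : ℝ) = 0 := by simp
                linarith [Real.log_two_lt_d9]
              have hexp := exp_le_one_add_add_sq (y := s * X) (by nlinarith)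
              have hrw : ‖circleMap 0 1 θ - a‖ ^ s = Real.exp (s * m) * Real.exp (s * X) := by
                rw [Real.rpow_def_of_pos hn, ← Real.exp_add]
                congr 1; rw [hX]; ring
              simp only [hrw]
              gcongr
              linarith
      _ = _ := by
          rw [intervalIntegral.integral_const_mul, intervalIntegral.integral_add (hi3.add hi1) hi2,
            intervalIntegral.integral_add hi3 hi1, intervalIntegral.integral_const_mul,
            intervalIntegral.integral_const_mul,
            intervalIntegral.integral_sub hilog intervalIntegrable_const,
            intervalIntegral.integral_add hi3 hig, hgK, hlog]
          simp only [intervalIntegral.integral_const, smul_eq_mul]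
          ring
  rw [Real.circleAverage_def, smul_eq_mul, Real.exp_add]
  calc _ ≤ (2 * Real.pi)⁻¹ * (Real.exp (s * m) *
        (2 * Real.pi + s ^ 2 * (64 * ‖a‖ ^ 2) * (2 * Real.pi + K))) := by gcongr
    _ = Real.exp (s * m) * (64 * (1 + K / (2 * Real.pi)) * s ^ 2 * ‖a‖ ^ 2 + 1) := by
        field_simp; ring
    _ ≤ _ := by
        gcongr
        exact Real.add_one_le_exp _

/-! ### Exponential Markov bounds for independent uniform angles -/

section Chernoff

variable {Ω : Type*} [MeasurableSpace Ω] {P : Measure Ω}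

theorem lintegral_comp_circleMap_of_isUniform {θ : Ω → ℝ} (hθ : Measurable θ)
    (hu : pdf.IsUniform θ (Set.Icc 0 (2 * Real.pi)) P volume) {g : ℂ → ℝ} (hg : Continuous g)
    (hg0 : ∀ z, 0 ≤ g z) :
    ∫⁻ ω, ENNReal.ofReal (g (circleMap 0 1 (θ ω))) ∂P
      = ENNReal.ofReal (Real.circleAverage g 0 1) := by
  have hπ := Real.pi_pos
  have hgc : Continuous fun x => g (circleMap 0 1 x) := hg.comp (continuous_circleMap 0 1)
  have hint : IntegrableOn (fun x => g (circleMap 0 1 x)) (Set.Icc 0 (2 * Real.pi)) :=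
    hgc.continuousOn.integrableOn_compact isCompact_Icc
  rw [← lintegral_map (f := fun x => ENNReal.ofReal (g (circleMap 0 1 x)))
    (by fun_prop) hθ, hu, ProbabilityTheory.cond, lintegral_smul_measure,
    ← ofReal_integral_eq_lintegral_ofReal hint (ae_of_all _ fun x => hg0 _),
    Real.circleAverage_def, Real.volume_Icc, smul_eq_mul, smul_eq_mul, sub_zero,
    ENNReal.ofReal_mul (p := (2 * Real.pi)⁻¹) (by positivity),
    ENNReal.ofReal_inv_of_pos (by positivity),
    intervalIntegral.integral_of_le (by positivity), integral_Icc_eq_integral_Ioc]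

/-- The exponential Markov inequality for products of functions of independent variables that are
uniformly distributed on the unit circle. -/
theorem measure_exp_le_prod_le {θ : ℕ → Ω → ℝ} (hθ : ∀ i, Measurable (θ i)) (hi : iIndepFun θ P)
    (hu : ∀ i, pdf.IsUniform (θ i) (Set.Icc 0 (2 * Real.pi)) P volume)
    (s : Finset ℕ) {g : ℕ → ℂ → ℝ} (hg : ∀ i, Continuous (g i)) (hg0 : ∀ i z, 0 ≤ g i z)
    {a : ℕ → ℝ} (ha : ∀ i ∈ s, Real.circleAverage (g i) 0 1 ≤ Real.exp (a i)) (τ : ℝ) :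
    P {ω | Real.exp (∑ i ∈ s, a i + τ) ≤ ∏ i ∈ s, g i (circleMap 0 1 (θ i ω))}
      ≤ ENNReal.ofReal (Real.exp (-τ)) := by
  have hm : ∀ i, Measurable fun x : ℝ => ENNReal.ofReal (g i (circleMap 0 1 x)) := fun i => by
    have : Continuous fun x => g i (circleMap 0 1 x) := (hg i).comp (continuous_circleMap 0 1)
    fun_prop
  have hmω : ∀ i, Measurable fun ω => ENNReal.ofReal (g i (circleMap 0 1 (θ i ω))) :=
    fun i => (hm i).comp (hθ i)
  have hE : ∫⁻ ω, ∏ i ∈ s, ENNReal.ofReal (g i (circleMap 0 1 (θ i ω))) ∂P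
      ≤ ENNReal.ofReal (Real.exp (∑ i ∈ s, a i)) := by
    rw [lintegral_prod_eq_prod_lintegral_of_indepFun s
      (fun i ω => ENNReal.ofReal (g i (circleMap 0 1 (θ i ω)))) (hi.comp _ hm) hmω,
      Real.exp_sum, ENNReal.ofReal_prod_of_nonneg fun i _ => (Real.exp_pos _).le]
    refine Finset.prod_le_prod' fun i his => ?_
    rw [lintegral_comp_circleMap_of_isUniform (hθ i) (hu i) (hg i) (hg0 i)]
    exact ENNReal.ofReal_le_ofReal (ha i his)
  have hset : {ω | Real.exp (∑ i ∈ s, a i + τ) ≤ ∏ i ∈ s, g i (circleMap 0 1 (θ i ω))}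
      = {ω | ENNReal.ofReal (Real.exp (∑ i ∈ s, a i + τ))
        ≤ ∏ i ∈ s, ENNReal.ofReal (g i (circleMap 0 1 (θ i ω)))} := by
    ext ω
    simp only [Set.mem_ofPred_eq]
    rw [← ENNReal.ofReal_prod_of_nonneg fun i _ => hg0 i _,
      ENNReal.ofReal_le_ofReal_iff (Finset.prod_nonneg fun i _ => hg0 i _)]
  rw [hset]
  refine (meas_ge_le_lintegral_div (Finset.measurable_fun_prod s fun i _ => hmω i).aemeasurable
    (by simpa using Real.exp_pos _) ENNReal.ofReal_ne_top).trans ?_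
  refine (ENNReal.div_le_div_right hE _).trans ?_
  rw [← ENNReal.ofReal_div_of_pos (Real.exp_pos _), ← Real.exp_sub]
  exact ENNReal.ofReal_le_ofReal (Real.exp_le_exp.2 (by linarith))

/-- The mean value property kills the linear term of exp for k ≠ 0, leaving 1 + ‖d‖². -/
theorem circleAverage_exp_re_le {d : ℂ} (hd : ‖d‖ ≤ 1) {k : ℕ} (hk : k ≠ 0) :
    Real.circleAverage (fun ζ => Real.exp (d * ζ ^ k).re) 0 1 ≤ Real.exp (‖d‖ ^ 2) := by
  have hci : ∀ f : ℂ → ℝ, Continuous f → CircleIntegrable f 0 1 := fun f hf =>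
    hf.continuousOn.circleIntegrable'
  have hc0 : CircleIntegrable (fun ζ => d * ζ ^ k) 0 1 :=
    Continuous.continuousOn (by fun_prop) |>.circleIntegrable'
  have hmean : Real.circleAverage (fun ζ => (d * ζ ^ k).re) 0 1 = 0 := by
    have h1 := Complex.reCLM.circleAverage_comp_comm hc0
    have h2 : Real.circleAverage (fun ζ : ℂ => d * ζ ^ k) 0 1 = 0 := by
      rw [DiffContOnCl.circleAverage (Differentiable.diffContOnCl (by fun_prop))]
      simp [hk]
    rw [h2] at h1
    simpa [Function.comp_def] using h1
  calc _ ≤ Real.circleAverage (fun ζ => (1 + ‖d‖ ^ 2) + (d * ζ ^ k).re) 0 1 := by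
        refine Real.circleAverage_mono (hci _ (by fun_prop)) (hci _ (by fun_prop)) fun ζ hζ => ?_
        have hζ1 : ‖ζ‖ = 1 := by simpa using hζ
        have hn : |(d * ζ ^ k).re| ≤ ‖d‖ := by
          refine (Complex.abs_re_le_norm _).trans ?_
          simp [hζ1]
        have := exp_le_one_add_add_sq ((le_abs_self _).trans (hn.trans hd))
        have h2 : (d * ζ ^ k).re ^ 2 ≤ ‖d‖ ^ 2 := by
          rw [← sq_abs]; gcongr
        linarith
    _ = 1 + ‖d‖ ^ 2 := by
        rw [Real.circleAverage_fun_add (hci _ (by fun_prop)) (hci _ (by fun_prop)), hmean,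
          Real.circleAverage_const, add_zero]
    _ ≤ _ := by linarith [Real.add_one_le_exp (‖d‖ ^ 2)]

theorem measure_le_re_sum_le {θ : ℕ → Ω → ℝ} (hθ : ∀ i, Measurable (θ i)) (hi : iIndepFun θ P)
    (hu : ∀ i, pdf.IsUniform (θ i) (Set.Icc 0 (2 * Real.pi)) P volume)
    (s : Finset ℕ) {k : ℕ} (hk : k ≠ 0) (d : ℕ → ℂ) (hd : ∀ i ∈ s, ‖d i‖ ≤ 1) (τ : ℝ) :
    P {ω | ∑ i ∈ s, ‖d i‖ ^ 2 + τ ≤ (∑ i ∈ s, d i * circleMap 0 1 (θ i ω) ^ k).re}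
      ≤ ENNReal.ofReal (Real.exp (-τ)) := by
  refine le_trans (measure_mono ?_) (measure_exp_le_prod_le hθ hi hu s
    (g := fun i ζ => Real.exp (d i * ζ ^ k).re) (fun i => by fun_prop)
    (fun i z => (Real.exp_pos _).le) (a := fun i => ‖d i‖ ^ 2)
    (fun i his => circleAverage_exp_re_le (hd i his) hk) τ)
  intro ω hω
  simp only [Set.mem_ofPred_eq] at hω ⊢
  rw [← Real.exp_sum, Real.exp_le_exp]
  simpa using hω

theorem norm_lt_two_mul_of_re_lt {w : ℂ} {B : ℝ} (h1 : w.re < B) (h2 : (-w).re < B)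
    (h3 : (Complex.I * w).re < B) (h4 : (-Complex.I * w).re < B) : ‖w‖ < 2 * B := by
  simp at h1 h2 h3 h4
  refine (Complex.norm_le_abs_re_add_abs_im w).trans_lt ?_
  have := abs_lt.2 ⟨by linarith, h1⟩
  have := abs_lt.2 ⟨by linarith, h4⟩
  linarith

/-- A complex number is bounded by its real parts in the four directions ±1, ±i. This accounts for
both the 2 and the 4. -/
theorem measure_le_norm_sum_le {θ : ℕ → Ω → ℝ} (hθ : ∀ i, Measurable (θ i)) (hi : iIndepFun θ P)
    (hu : ∀ i, pdf.IsUniform (θ i) (Set.Icc 0 (2 * Real.pi)) P volume)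
    (s : Finset ℕ) {k : ℕ} (hk : k ≠ 0) (d : ℕ → ℂ) (hd : ∀ i ∈ s, ‖d i‖ ≤ 1) (τ : ℝ) :
    P {ω | 2 * (∑ i ∈ s, ‖d i‖ ^ 2 + τ) ≤ ‖∑ i ∈ s, d i * circleMap 0 1 (θ i ω) ^ k‖}
      ≤ ENNReal.ofReal (4 * Real.exp (-τ)) := by
  have key : ∀ e : ℂ, ‖e‖ = 1 →
      P {ω | ∑ i ∈ s, ‖d i‖ ^ 2 + τ ≤ (e * ∑ i ∈ s, d i * circleMap 0 1 (θ i ω) ^ k).re}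
        ≤ ENNReal.ofReal (Real.exp (-τ)) := fun e he => by
    have := measure_le_re_sum_le hθ hi hu s hk (fun i => e * d i)
      (fun i his => by simpa [he] using hd i his) τ
    simpa [he, Finset.mul_sum, mul_assoc] using this
  have hsub : {ω | 2 * (∑ i ∈ s, ‖d i‖ ^ 2 + τ) ≤ ‖∑ i ∈ s, d i * circleMap 0 1 (θ i ω) ^ k‖}
      ⊆ (({ω | ∑ i ∈ s, ‖d i‖ ^ 2 + τ ≤ (1 * ∑ i ∈ s, d i * circleMap 0 1 (θ i ω) ^ k).re} ∪
        {ω | ∑ i ∈ s, ‖d i‖ ^ 2 + τ ≤ (-1 * ∑ i ∈ s, d i * circleMap 0 1 (θ i ω) ^ k).re}) ∪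
        ({ω | ∑ i ∈ s, ‖d i‖ ^ 2 + τ ≤
          (Complex.I * ∑ i ∈ s, d i * circleMap 0 1 (θ i ω) ^ k).re} ∪
        {ω | ∑ i ∈ s, ‖d i‖ ^ 2 + τ ≤
          (-Complex.I * ∑ i ∈ s, d i * circleMap 0 1 (θ i ω) ^ k).re})) := by
    intro ω hω
    by_contra hc
    simp only [Set.mem_union, Set.mem_ofPred_eq, not_or, not_le, one_mul, neg_one_mul] at hc hω
    exact absurd hω (not_le.2 (norm_lt_two_mul_of_re_lt hc.1.1 hc.1.2 hc.2.1 hc.2.2))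
  have h1 := key 1 (by simp)
  have h2 := key (-1) (by simp)
  have h3 := key Complex.I (by simp)
  have h4 := key (-Complex.I) (by simp)
  refine (measure_mono hsub).trans ((measure_union_le _ _).trans ?_)
  refine (add_le_add ((measure_union_le _ _).trans (add_le_add h1 h2))
    ((measure_union_le _ _).trans (add_le_add h3 h4))).trans ?_
  have hp := (Real.exp_pos (-τ)).le
  rw [← ENNReal.ofReal_add hp hp, ← ENNReal.ofReal_add (by positivity) (by positivity)]
  exact ENNReal.ofReal_le_ofReal (by linarith)

theorem ae_eventually_notMem_of_summable {E : ℕ → Set Ω} {u : ℕ → ℝ} (hu : Summable u)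
    (h : ∀ᶠ j in atTop, P (E j) ≤ ENNReal.ofReal (u j)) :
    ∀ᵐ ω ∂P, ∀ᶠ j in atTop, ω ∉ E j := by
  obtain ⟨J, hJ⟩ := eventually_atTop.1 h
  have hs : ∑' j, P (E (j + J)) ≠ ⊤ := by
    refine ne_top_of_le_ne_top ?_ (ENNReal.tsum_le_tsum fun j => hJ (j + J) (by omega))
    have := ((summable_nat_add_iff J).2 hu).tsum_ofReal_ne_top
    exact this
  filter_upwards [ae_eventually_notMem hs] with ω hω
  obtain ⟨K, hK⟩ := eventually_atTop.1 hω
  refine eventually_atTop.2 ⟨K + J, fun j hj => ?_⟩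
  have := hK (j - J) (by omega)
  rwa [Nat.sub_add_cancel (by omega)] at this

end Chernoff

/-! ### Polynomials sampled at roots of unity -/

/-- Discrete Fourier inversion: since the degree is below L, no two coefficients alias. It bounds
each coefficient by the sampled values. -/
theorem IsPrimitiveRoot.sum_eval_mul_pow_inv {L : ℕ} {ζ : ℂ} (hζ : IsPrimitiveRoot ζ L)
    (hL : 0 < L) {Q : Polynomial ℂ} (hQ : Q.natDegree < L) (R : ℂ) {m : ℕ} (hm : m < L) :
    ∑ l ∈ Finset.range L, Q.eval (R * ζ ^ l) * ((ζ ^ m)⁻¹) ^ l = L * (Q.coeff m * R ^ m) := by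
  have hζ0 : ζ ≠ 0 := hζ.ne_zero hL.ne'
  have h1 : ∀ l, Q.eval (R * ζ ^ l) * ((ζ ^ m)⁻¹) ^ l
      = ∑ n ∈ Finset.range L, Q.coeff n * R ^ n * (ζ ^ n * (ζ ^ m)⁻¹) ^ l := fun l => by
    rw [Polynomial.eval_eq_sum_range' hQ, Finset.sum_mul]
    refine Finset.sum_congr rfl fun n _ => ?_
    rw [mul_pow, mul_pow, ← pow_mul, ← pow_mul, mul_comm l n]; ring
  simp_rw [h1]
  rw [Finset.sum_comm]
  simp_rw [← Finset.mul_sum]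
  rw [Finset.sum_eq_single_of_mem m (Finset.mem_range.2 hm)]
  · rw [mul_inv_cancel₀ (pow_ne_zero _ hζ0)]
    simp; ring
  · intro n hn hnm
    have hne : ζ ^ n * (ζ ^ m)⁻¹ ≠ 1 := by
      rw [Ne, mul_inv_eq_one₀ (pow_ne_zero _ hζ0)]
      exact fun h => hnm (hζ.pow_inj (Finset.mem_range.1 hn) hm h)
    rw [geom_sum_eq hne, mul_pow, inv_pow, ← pow_mul, ← pow_mul, mul_comm n, mul_comm m, pow_mul,
      pow_mul, hζ.pow_eq_one]
    simp

/-- A polynomial of degree less than `L` is controlled on a disk by its values at the `L` vertices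
of a regular polygon inscribed in the boundary. -/
theorem Polynomial.norm_eval_le_of_norm_eval_le_on_rootsOfUnity {L : ℕ} {ζ : ℂ}
    (hζ : IsPrimitiveRoot ζ L) (hL : 0 < L) {Q : Polynomial ℂ} (hQ : Q.natDegree < L) {R B : ℝ}
    (hR : 0 ≤ R) (hB : ∀ l < L, ‖Q.eval ((R : ℂ) * ζ ^ l)‖ ≤ B) {z : ℂ} (hz : ‖z‖ ≤ R) :
    ‖Q.eval z‖ ≤ L * B := by
  have hζ1 : ‖ζ‖ = 1 := hζ.norm'_eq_one hL.ne'
  have hL' : (0 : ℝ) < L := by exact_mod_cast hL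
  have hcoef : ∀ m < L, ‖Q.coeff m‖ * R ^ m ≤ B := fun m hm => by
    have h := congrArg norm (hζ.sum_eval_mul_pow_inv hL hQ (R : ℂ) hm)
    have h2 : ‖∑ l ∈ Finset.range L, Q.eval ((R : ℂ) * ζ ^ l) * ((ζ ^ m)⁻¹) ^ l‖ ≤ L * B := by
      refine (norm_sum_le _ _).trans ?_
      calc _ ≤ ∑ l ∈ Finset.range L, B := Finset.sum_le_sum fun l hl => by
            simpa [hζ1] using hB l (Finset.mem_range.1 hl)
        _ = _ := by simp
    rw [h, norm_mul, norm_mul, norm_pow, Complex.norm_natCast, Complex.norm_real,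
      Real.norm_of_nonneg hR] at h2
    exact le_of_mul_le_mul_left h2 hL'
  rw [Polynomial.eval_eq_sum_range' hQ]
  refine (norm_sum_le _ _).trans ?_
  calc _ ≤ ∑ m ∈ Finset.range L, B := Finset.sum_le_sum fun m hm => by
        rw [norm_mul, norm_pow]
        refine le_trans ?_ (hcoef m (Finset.mem_range.1 hm))
        gcongr
    _ = _ := by simp

/-! ### Counting the moduli and the deterministic gain -/

section Counting

variable {r : ℕ → ℝ}

/-- The first index at which the sequence `r` reaches the level `t`. -/
noncomputable def firstIndexGe (r : ℕ → ℝ) (t : ℝ) : ℕ := sInf {i | t ≤ r i}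

theorem le_apply_iff_firstIndexGe_le (hr : StrictMono r) (h : Tendsto r atTop atTop) {t : ℝ}
    {i : ℕ} : t ≤ r i ↔ firstIndexGe r t ≤ i := by
  have hne : {i | t ≤ r i}.Nonempty := (h.eventually_ge_atTop t).exists
  refine ⟨fun hi => Nat.sInf_le hi, fun hi => ?_⟩
  have h1 : t ≤ r (firstIndexGe r t) := Nat.sInf_mem hne
  exact h1.trans (hr.monotone hi)

theorem apply_lt_iff_lt_firstIndexGe (hr : StrictMono r) (h : Tendsto r atTop atTop) {t : ℝ}
    {i : ℕ} : r i < t ↔ i < firstIndexGe r t := by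
  rw [← not_le, le_apply_iff_firstIndexGe_le hr h, not_le]

theorem tendsto_firstIndexGe (hr : StrictMono r) (h : Tendsto r atTop atTop) :
    Tendsto (firstIndexGe r) atTop atTop := by
  refine tendsto_atTop.2 fun n => ?_
  filter_upwards [eventually_gt_atTop (r n)] with t ht
  exact ((apply_lt_iff_lt_firstIndexGe hr h).1 ht).le

theorem tendsto_atTop_of_tendsto_sq_div (h1 : ∀ i, 1 ≤ r i)
    (hlim : Tendsto (fun i : ℕ => r i ^ 2 / ((i : ℝ) + 1)) atTop (𝓝 1)) :
    Tendsto r atTop atTop := by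
  have h2 : Tendsto (fun i : ℕ => (i : ℝ) + 1) atTop atTop :=
    tendsto_atTop_add_const_right _ _ tendsto_natCast_atTop_atTop
  have h3 : Tendsto (fun i : ℕ => r i ^ 2) atTop atTop := by
    refine (hlim.pos_mul_atTop one_pos h2).congr fun i => ?_
    field_simp
  have h4 : Tendsto (fun i : ℕ => √(r i ^ 2)) atTop atTop := Real.tendsto_sqrt_atTop.comp h3
  refine h4.congr fun i => Real.sqrt_sq (by linarith [h1 i])

/-- With N the first index at level t, t²/N lies between r_{N-1}²/N and r_N²/N, and both tend to 1.
-/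
theorem tendsto_firstIndexGe_div_sq (hr : StrictMono r) (h1 : ∀ i, 1 ≤ r i)
    (hlim : Tendsto (fun i : ℕ => r i ^ 2 / ((i : ℝ) + 1)) atTop (𝓝 1)) :
    Tendsto (fun t : ℝ => (firstIndexGe r t : ℝ) / t ^ 2) atTop (𝓝 1) := by
  have htop := tendsto_atTop_of_tendsto_sq_div h1 hlim
  have hN := tendsto_firstIndexGe hr htop
  have hlow : Tendsto (fun t : ℝ => r (firstIndexGe r t - 1) ^ 2 /
      (((firstIndexGe r t - 1 : ℕ) : ℝ) + 1)) atTop (𝓝 1) :=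
    hlim.comp ((tendsto_sub_atTop_nat 1).comp hN)
  have hfrac : Tendsto (fun n : ℕ => ((n : ℝ) + 1) / n) atTop (𝓝 1) := by
    have := (tendsto_one_div_atTop_nhds_zero_nat (𝕜 := ℝ)).const_add 1
    rw [add_zero] at this
    refine this.congr' ?_
    filter_upwards [eventually_gt_atTop 0] with n hn
    have : (0 : ℝ) < n := by exact_mod_cast hn
    field_simp
  have hup : Tendsto (fun t : ℝ => r (firstIndexGe r t) ^ 2 / ((firstIndexGe r t : ℝ) + 1)
      * (((firstIndexGe r t : ℝ) + 1) / firstIndexGe r t)) atTop (𝓝 1) := by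
    have := (hlim.comp hN).mul (hfrac.comp hN)
    rw [one_mul] at this
    exact this
  have hmid : Tendsto (fun t : ℝ => t ^ 2 / (firstIndexGe r t : ℝ)) atTop (𝓝 1) := by
    refine tendsto_of_tendsto_of_tendsto_of_le_of_le' hlow hup ?_ ?_
    · filter_upwards [hN.eventually_gt_atTop 0, eventually_gt_atTop 0] with t ht ht0
      have hlt : r (firstIndexGe r t - 1) < t :=
        (apply_lt_iff_lt_firstIndexGe hr htop).2 (by omega)
      have hc : ((firstIndexGe r t - 1 : ℕ) : ℝ) + 1 = firstIndexGe r t := by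
        rw [Nat.cast_sub (by omega)]; simp
      rw [hc]
      have := h1 (firstIndexGe r t - 1)
      gcongr
    · filter_upwards [hN.eventually_gt_atTop 0, eventually_gt_atTop 0] with t ht ht0
      have hle : t ≤ r (firstIndexGe r t) := (le_apply_iff_firstIndexGe_le hr htop).2 le_rfl
      have hpos : (0 : ℝ) < firstIndexGe r t := by exact_mod_cast ht
      rw [div_mul_div_cancel₀ (by positivity)]
      gcongr
  have := hmid.inv₀ one_ne_zero
  simpa using this

/-- The sum is log(x^N / N!), and x^N / N! is one term of the series of e^x. -/
theorem sum_log_div_succ_le {x : ℝ} (hx : 0 < x) (N : ℕ) :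
    ∑ i ∈ Finset.range N, Real.log (x / ((i : ℝ) + 1)) ≤ x := by
  have hpos : ∀ i : ℕ, 0 < x / ((i : ℝ) + 1) := fun i => by positivity
  rw [← Real.log_prod fun i _ => (hpos i).ne',
    Real.log_le_iff_le_exp (Finset.prod_pos fun i _ => hpos i), Finset.prod_div_distrib,
    Finset.prod_const, Finset.card_range]
  have : ∏ i ∈ Finset.range N, ((i : ℝ) + 1) = (N.factorial : ℝ) := by
    rw [← Finset.prod_range_add_one_eq_factorial]; push_cast; rfl
  rw [this]
  exact Real.pow_div_factorial_le_exp x hx.le N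

theorem eventually_log_sq_div_ge {K : ℝ} (hK : 0 ≤ K)
    (hgrow : ∀ᶠ i : ℕ in atTop,
      ((i : ℝ) + 1) + K * √((i : ℝ) + 1) * Real.log ((i : ℝ) + 1) ≤ r i ^ 2) :
    ∀ᶠ i : ℕ in atTop, K * Real.log ((i : ℝ) + 1) / (2 * √((i : ℝ) + 1))
      ≤ Real.log (r i ^ 2 / ((i : ℝ) + 1)) := by
  have hsmall : Tendsto (fun i : ℕ => K * (Real.log ((i : ℝ) + 1) / √((i : ℝ) + 1)))
      atTop (𝓝 0) := by
    have h0 : Tendsto (fun x : ℝ => Real.log x / √x) atTop (𝓝 0) := by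
      have := (isLittleO_log_rpow_atTop (r := 1 / 2) (by norm_num)).tendsto_div_nhds_zero
      simpa [Real.sqrt_eq_rpow] using this
    have h2 : Tendsto (fun i : ℕ => (i : ℝ) + 1) atTop atTop :=
      tendsto_atTop_add_const_right _ _ tendsto_natCast_atTop_atTop
    simpa using (h0.comp h2).const_mul K
  filter_upwards [hgrow, hsmall.eventually_le_const one_pos] with i hi hs
  have hi0 : (0 : ℝ) < (i : ℝ) + 1 := by positivity
  set x := (i : ℝ) + 1 with hx
  have hsq : 0 < √x := Real.sqrt_pos.2 hi0
  have hss : √x * √x = x := Real.mul_self_sqrt hi0.le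
  have hlog : 0 ≤ Real.log x := Real.log_nonneg (by rw [hx]; linarith [Nat.cast_nonneg (α := ℝ) i])
  set w := K * (Real.log x / √x) with hw
  have hw0 : 0 ≤ w := by positivity
  have h1 : 1 + w ≤ r i ^ 2 / x := by
    rw [le_div_iff₀ hi0]
    calc (1 + w) * x = x + K * √x * Real.log x := by
          have h5 : x / √x = √x := Real.div_sqrt
          calc (1 + w) * x = x + K * Real.log x * (x / √x) := by rw [hw]; ring
            _ = _ := by rw [h5]; ring
      _ ≤ _ := hi
  refine le_trans ?_ (Real.log_le_log (by positivity) h1)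
  have h2 := Real.one_sub_inv_le_log_of_pos (show 0 < 1 + w by linarith)
  have h3 : w / 2 ≤ 1 - (1 + w)⁻¹ := by
    rw [le_sub_iff_add_le, ← le_sub_iff_add_le', inv_le_iff_one_le_mul₀ (by linarith)]
    nlinarith
  have h4 : K * Real.log x / (2 * √x) = w / 2 := by rw [hw]; field_simp
  linarith

/-- The mean of the logarithm of the modulus of the product, compared with the weight. -/
theorem eventually_sum_posLog_le (hr : StrictMono r) (h1 : ∀ i, 1 ≤ r i)
    (hlim : Tendsto (fun i : ℕ => r i ^ 2 / ((i : ℝ) + 1)) atTop (𝓝 1))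
    (hgrow : ∀ K : ℝ, ∀ᶠ i : ℕ in atTop,
      ((i : ℝ) + 1) + K * √((i : ℝ) + 1) * Real.log ((i : ℝ) + 1) ≤ r i ^ 2) (K : ℝ) :
    ∀ᶠ t : ℝ in atTop, ∀ M : ℕ, ∑ i ∈ Finset.range M, Real.posLog (t / r i)
      ≤ t ^ 2 / 2 - K * t * Real.log t := by
  have htop := tendsto_atTop_of_tendsto_sq_div h1 hlim
  have hN := tendsto_firstIndexGe hr htop
  -- The later steps keep K'/16 = |K| + 1 of the gain: a factor 1/8 from the upper half of the
  -- indices and 1/2 from log r² = 2 log r. The spare t log t absorbs the first n₀ terms.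
  set K' := 16 * (|K| + 1) with hK'
  have hK0 : 0 ≤ K' := by positivity
  obtain ⟨n₀, hn₀⟩ := eventually_atTop.1 (eventually_log_sq_div_ge hK0 (hgrow K'))
  set u : ℕ → ℝ := fun i => Real.log (r i ^ 2 / ((i : ℝ) + 1)) with hu
  set B := ∑ i ∈ Finset.range n₀, |u i| with hB
  have hu0 : ∀ i ≥ n₀, 0 ≤ u i := fun i hi => by
    refine le_trans ?_ (hn₀ i hi)
    have : 0 ≤ Real.log ((i : ℝ) + 1) :=
      Real.log_nonneg (by linarith [Nat.cast_nonneg (α := ℝ) i])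
    positivity
  have hdens := (tendsto_firstIndexGe_div_sq hr h1 hlim).eventually
    (eventually_ge_nhds (show (1 / 2 : ℝ) < 1 by norm_num))
  have hBt : ∀ᶠ t : ℝ in atTop, B / 2 ≤ t * Real.log t := by
    filter_upwards [(tendsto_id.atTop_mul_atTop₀ Real.tendsto_log_atTop).eventually_ge_atTop
      (B / 2)] with t ht using ht
  filter_upwards [hdens, hBt, eventually_ge_atTop 4, hN.eventually_ge_atTop (2 * n₀ + 2)]
    with t hd hBt ht4 hNn M
  set N := firstIndexGe r t
  have ht0 : 0 < t := by linarith
  have hrpos : ∀ i, 0 < r i := fun i => by linarith [h1 i]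
  have hlogt : 0 ≤ Real.log t := Real.log_nonneg (by linarith)
  have hNt : t ^ 2 / 2 ≤ N := by
    rw [le_div_iff₀ (by positivity)] at hd; linarith
  -- Indices from N on contribute nothing, so the bound is uniform in M.
  have hzero : ∀ i ∉ Finset.range N, Real.posLog (t / r i) = 0 := fun i hi => by
    rw [Finset.mem_range, not_lt] at hi
    have := (le_apply_iff_firstIndexGe_le hr htop).2 hi
    rw [Real.posLog_eq_zero_iff, abs_of_pos (div_pos ht0 (hrpos i))]
    exact (div_le_one (hrpos i)).2 this
  have hstep1 : ∑ i ∈ Finset.range M, Real.posLog (t / r i)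
      ≤ ∑ i ∈ Finset.range N, Real.posLog (t / r i) := by
    calc _ ≤ ∑ i ∈ Finset.range M ∪ Finset.range N, Real.posLog (t / r i) :=
          Finset.sum_le_sum_of_subset_of_nonneg Finset.subset_union_left
            fun _ _ _ => Real.posLog_nonneg
      _ = _ := (Finset.sum_subset Finset.subset_union_right fun i _ hi => hzero i hi).symm
  have hterm : ∀ i ∈ Finset.range N, Real.posLog (t / r i)
      = (Real.log (t ^ 2 / ((i : ℝ) + 1)) - u i) / 2 := fun i hi => by
    have hlt := (apply_lt_iff_lt_firstIndexGe hr htop).2 (Finset.mem_range.1 hi)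
    have hi0 : (0 : ℝ) < (i : ℝ) + 1 := by positivity
    have hri := hrpos i
    rw [Real.posLog_eq_log (by
      rw [abs_of_pos (div_pos ht0 hri)]; exact ((one_lt_div hri).2 hlt).le), hu]
    simp only
    rw [Real.log_div ht0.ne' hri.ne', Real.log_div (by positivity) hi0.ne',
      Real.log_div (by positivity) hi0.ne', Real.log_pow, Real.log_pow]
    push_cast; ring
  have hsumu : K' * t * Real.log t / 8 - B ≤ ∑ i ∈ Finset.range N, u i := by
    have hNr : (8 : ℝ) ≤ N := by nlinarith
    have hN0 : (0 : ℝ) < N := by linarith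
    have hsplit : ∑ i ∈ Finset.range n₀, u i + ∑ i ∈ Finset.Ico (N / 2) N, u i
        ≤ ∑ i ∈ Finset.range N, u i := by
      rw [← Finset.sum_range_add_sum_Ico u (show n₀ ≤ N by omega)]
      refine add_le_add le_rfl (Finset.sum_le_sum_of_subset_of_nonneg
        (Finset.Ico_subset_Ico (by omega) le_rfl) fun i hi _ => hu0 i (Finset.mem_Ico.1 hi).1)
    have hfirst : -B ≤ ∑ i ∈ Finset.range n₀, u i := by
      rw [hB, ← Finset.sum_neg_distrib]
      exact Finset.sum_le_sum fun i _ => neg_abs_le _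
    have hsqrt : t / 2 ≤ √(N : ℝ) := by
      refine Real.le_sqrt_of_sq_le ?_
      nlinarith
    have hlogN : Real.log t ≤ Real.log ((N : ℝ) / 2) := by
      refine Real.log_le_log ht0 ?_
      nlinarith
    -- At least N/2 indices each contribute K' log t / (2√N), and √N ≥ t/2.
    have hsecond : K' * t * Real.log t / 8 ≤ ∑ i ∈ Finset.Ico (N / 2) N, u i := by
      have hs0 : 0 < √(N : ℝ) := by linarith
      have hcard : (N : ℝ) / 2 ≤ ((Finset.Ico (N / 2) N).card : ℝ) := by
        rw [Nat.card_Ico, Nat.cast_sub (by omega)]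
        have : ((N / 2 : ℕ) : ℝ) ≤ (N : ℝ) / 2 := Nat.cast_div_le
        linarith
      have hlow : ∀ i ∈ Finset.Ico (N / 2) N, K' * Real.log t / (2 * √(N : ℝ)) ≤ u i := by
        intro i hi
        obtain ⟨ha, hb⟩ := Finset.mem_Ico.1 hi
        refine le_trans ?_ (hn₀ i (by omega))
        have e1 : (i : ℝ) + 1 ≤ N := by exact_mod_cast hb
        have e2 : (N : ℝ) / 2 ≤ (i : ℝ) + 1 := by
          have : (N : ℝ) ≤ 2 * (i + 1) := by exact_mod_cast (by omega : N ≤ 2 * (i + 1))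
          linarith
        have e3 : Real.log t ≤ Real.log ((i : ℝ) + 1) :=
          hlogN.trans (Real.log_le_log (by linarith) e2)
        have e4 : √((i : ℝ) + 1) ≤ √(N : ℝ) := Real.sqrt_le_sqrt e1
        have e5 : 0 < √((i : ℝ) + 1) := Real.sqrt_pos.2 (by positivity)
        have e6 : 0 ≤ Real.log ((i : ℝ) + 1) := hlogt.trans e3
        gcongr
      have hsum := Finset.card_nsmul_le_sum _ u _ hlow
      rw [nsmul_eq_mul] at hsum
      refine le_trans ?_ hsum
      calc K' * t * Real.log t / 8 = K' * Real.log t / 4 * (t / 2) := by ring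
        _ ≤ K' * Real.log t / 4 * √(N : ℝ) := by gcongr
        _ = ((N : ℝ) / 2) * (K' * Real.log t / (2 * √(N : ℝ))) := by
            have hs3 : (N : ℝ) / √(N : ℝ) = √(N : ℝ) := Real.div_sqrt
            calc _ = K' * Real.log t / 4 * ((N : ℝ) / √(N : ℝ)) := by rw [hs3]
              _ = _ := by ring
        _ ≤ _ := by gcongr
    linarith
  refine hstep1.trans ?_
  rw [Finset.sum_congr rfl hterm, ← Finset.sum_div, Finset.sum_sub_distrib]
  have hS := sum_log_div_succ_le (x := t ^ 2) (by positivity) N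
  have hKK : K * t * Real.log t ≤ |K| * t * Real.log t := by
    gcongr; exact le_abs_self K
  have : K' * t * Real.log t = 16 * (|K| * t * Real.log t) + 16 * (t * Real.log t) := by
    rw [hK']; ring
  linarith

end Counting

/-! ### Convergence along blocks and power sums of the moduli -/

/-- The tail of ∑ n⁻³ from j is at most j⁻¹ ∑ n⁻². -/
theorem exists_forall_norm_sub_le_div {C : ℕ → ℂ}
    (h : ∀ᶠ j : ℕ in atTop, ‖C (j + 1) - C j‖ ≤ 1 / (j : ℝ) ^ 3) :
    ∃ c : ℂ, ∃ K : ℝ, ∀ᶠ j : ℕ in atTop, ‖c - C j‖ ≤ K / j := by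
  obtain ⟨J, hJ⟩ := eventually_atTop.1 (h.and (eventually_ge_atTop 1))
  have hJ1 : 1 ≤ J := (hJ J le_rfl).2
  have hs2 : Summable fun m : ℕ => 1 / ((m : ℝ) + J) ^ 2 := by
    have := (summable_nat_add_iff J).2 (Real.summable_one_div_nat_pow.2 one_lt_two)
    simpa using this
  have hs3 : Summable fun m : ℕ => 1 / ((m : ℝ) + J) ^ 3 := by
    have := (summable_nat_add_iff J).2 (Real.summable_one_div_nat_pow.2 (show 1 < 3 by norm_num))
    simpa using this
  have hd : ∀ n, dist (C (n + J)) (C ((n + 1) + J)) ≤ 1 / ((n : ℝ) + J) ^ 3 := fun n => by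
    rw [dist_comm, dist_eq_norm]
    have := (hJ (n + J) (by omega)).1
    push_cast at this
    rwa [show n + 1 + J = n + J + 1 by ring]
  obtain ⟨c, hc⟩ := cauchySeq_tendsto_of_complete (cauchySeq_of_dist_le_of_summable _ hd hs3)
  refine ⟨c, ∑' m : ℕ, 1 / ((m : ℝ) + J) ^ 2, eventually_atTop.2 ⟨J, fun j hj => ?_⟩⟩
  have hb := dist_le_tsum_of_dist_le_of_tendsto _ hd hs3 hc (j - J)
  rw [dist_comm, dist_eq_norm, Nat.sub_add_cancel hj] at hb
  refine hb.trans ?_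
  rw [div_eq_mul_inv, ← tsum_mul_right]
  have hj0 : (0 : ℝ) < j := by exact_mod_cast (by omega : 0 < j)
  have hcast : ∀ m : ℕ, (((j - J + m : ℕ) : ℝ) + J) = m + j := fun m => by
    have : ((j - J + m : ℕ) : ℝ) + J = ((j - J + m + J : ℕ) : ℝ) := by push_cast; ring
    rw [this, show j - J + m + J = m + j by omega]; push_cast; ring
  refine Summable.tsum_le_tsum (fun m => ?_) ?_ (hs2.mul_right _)
  · rw [hcast, one_div, one_div, ← mul_inv]
    have hJ0 : (0 : ℝ) < J := by exact_mod_cast hJ1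
    have hm : (0 : ℝ) ≤ m := Nat.cast_nonneg m
    have hJj : (J : ℝ) ≤ j := by exact_mod_cast hj
    refine inv_anti₀ (by positivity) ?_
    calc ((m : ℝ) + J) ^ 2 * j ≤ ((m : ℝ) + j) ^ 2 * (m + j) := by gcongr; linarith
      _ = _ := by ring
  · have := (summable_nat_add_iff (j - J)).2 hs3
    refine this.congr fun m => ?_
    rw [add_comm m]

section Moduli

variable {r : ℕ → ℝ} {c : ℝ}

theorem exists_sum_one_div_sq_le_log (hc : 0 < c)
    (hlow : ∀ i : ℕ, c * ((i : ℝ) + 1) ≤ r i ^ 2) :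
    ∃ C : ℝ, 0 < C ∧ ∀ j : ℕ, 3 ≤ j →
      ∑ i ∈ Finset.range (j ^ 12), 1 / r i ^ 2 ≤ C * Real.log j := by
  -- The harmonic sum up to j¹² is at most 1 + 12 log j, and log j ≥ 1 for j ≥ 3.
  refine ⟨13 / c, by positivity, fun j hj => ?_⟩
  have hlog : 1 ≤ Real.log j := by
    rw [Real.le_log_iff_exp_le (by positivity)]
    have : (3 : ℝ) ≤ j := by exact_mod_cast hj
    linarith [Real.exp_one_lt_d9]
  have hH := harmonic_le_one_add_log (j ^ 12)
  rw [harmonic] at hH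
  push_cast at hH
  rw [Real.log_pow] at hH
  calc _ ≤ ∑ i ∈ Finset.range (j ^ 12), c⁻¹ * ((i : ℝ) + 1)⁻¹ :=
        Finset.sum_le_sum fun i _ => by
          rw [one_div, ← mul_inv]
          exact inv_anti₀ (by positivity) (hlow i)
    _ = c⁻¹ * ∑ i ∈ Finset.range (j ^ 12), ((i : ℝ) + 1)⁻¹ := by rw [Finset.mul_sum]
    _ ≤ c⁻¹ * (1 + 12 * Real.log j) := by
        gcongr
        simpa using hH
    _ ≤ c⁻¹ * (13 * Real.log j) := by gcongr; linarith
    _ = _ := by ring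

theorem summable_succ_rpow : Summable fun i : ℕ => ((i : ℝ) + 1) ^ (-(5 / 4) : ℝ) := by
  have := (summable_nat_add_iff 1).2
    (Real.summable_nat_rpow.2 (show (-(5 / 4) : ℝ) < -1 by norm_num))
  simpa using this

theorem pow_le_succ_rpow {i j : ℕ} (h : j ^ 12 ≤ i) (n : ℕ) :
    (j : ℝ) ^ n ≤ ((i : ℝ) + 1) ^ ((n : ℝ) / 12) := by
  have h1 : (j : ℝ) ^ 12 ≤ (i : ℝ) + 1 := by
    have : ((j ^ 12 : ℕ) : ℝ) ≤ i := by exact_mod_cast h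
    push_cast at this; linarith
  have hj : (0 : ℝ) ≤ j := Nat.cast_nonneg j
  calc (j : ℝ) ^ n = ((j : ℝ) ^ 12) ^ ((n : ℝ) / 12) := by
        rw [← Real.rpow_natCast (j : ℝ) 12, ← Real.rpow_mul hj, ← Real.rpow_natCast]
        congr 1; push_cast; ring
    _ ≤ _ := by gcongr

/-- The truncation exponent 12 pays here: j⁹ ≤ (i+1)^(3/4) against the decay (i+1)^(-2) leaves the
summable exponent -5/4. -/
theorem pow_mul_one_div_pow_four_le (hc : 0 < c) (hlow : ∀ i : ℕ, c * ((i : ℝ) + 1) ≤ r i ^ 2)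
    {i j : ℕ} (h : j ^ 12 ≤ i) :
    (j : ℝ) ^ 9 * (1 / r i ^ 2) ^ 2 ≤ (c ^ 2)⁻¹ * ((i : ℝ) + 1) ^ (-(5 / 4) : ℝ) := by
  have hi : (0 : ℝ) < (i : ℝ) + 1 := by positivity
  have h1 : (1 / r i ^ 2) ^ 2 ≤ (c ^ 2)⁻¹ * ((i : ℝ) + 1) ^ (-2 : ℝ) := by
    rw [one_div, Real.rpow_neg hi.le, inv_pow, ← mul_inv]
    refine inv_anti₀ (by positivity) ?_
    have := pow_le_pow_left₀ (by positivity) (hlow i) 2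
    rw [mul_pow] at this
    exact_mod_cast this
  calc _ ≤ ((i : ℝ) + 1) ^ (((9 : ℕ) : ℝ) / 12) * ((c ^ 2)⁻¹ * ((i : ℝ) + 1) ^ (-2 : ℝ)) := by
        gcongr
        exact pow_le_succ_rpow h 9
    _ = (c ^ 2)⁻¹ * (((i : ℝ) + 1) ^ (((9 : ℕ) : ℝ) / 12) * ((i : ℝ) + 1) ^ (-2 : ℝ)) := by ring
    _ = _ := by rw [← Real.rpow_add hi]; norm_num

theorem pow_mul_one_div_pow_three_le (hc : 0 < c) (h1 : ∀ i, 1 ≤ r i)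
    (hlow : ∀ i : ℕ, c * ((i : ℝ) + 1) ≤ r i ^ 2) {i j : ℕ} (h : j ^ 12 ≤ i) :
    (j : ℝ) ^ 3 * (1 / r i) ^ 3 ≤ (c ^ (3 / 2 : ℝ))⁻¹ * ((i : ℝ) + 1) ^ (-(5 / 4) : ℝ) := by
  have hi : (0 : ℝ) < (i : ℝ) + 1 := by positivity
  have hr : 0 ≤ r i := by linarith [h1 i]
  have h1 : (1 / r i) ^ 3 ≤ (c ^ (3 / 2 : ℝ))⁻¹ * ((i : ℝ) + 1) ^ (-(3 / 2) : ℝ) := by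
    rw [one_div, Real.rpow_neg hi.le, inv_pow, ← mul_inv]
    refine inv_anti₀ (by positivity) ?_
    have := Real.rpow_le_rpow (by positivity) (hlow i) (show (0 : ℝ) ≤ 3 / 2 by norm_num)
    rw [Real.mul_rpow hc.le hi.le] at this
    refine this.trans_eq ?_
    rw [← Real.rpow_natCast, ← Real.rpow_mul hr, ← Real.rpow_natCast]
    norm_num
  calc _ ≤ ((i : ℝ) + 1) ^ (((3 : ℕ) : ℝ) / 12)
          * ((c ^ (3 / 2 : ℝ))⁻¹ * ((i : ℝ) + 1) ^ (-(3 / 2) : ℝ)) := by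
        gcongr
        exact pow_le_succ_rpow h 3
    _ = (c ^ (3 / 2 : ℝ))⁻¹ * (((i : ℝ) + 1) ^ (((3 : ℕ) : ℝ) / 12)
          * ((i : ℝ) + 1) ^ (-(3 / 2) : ℝ)) := by ring
    _ = _ := by rw [← Real.rpow_add hi]; norm_num

theorem eventually_two_mul_le_apply (hc : 0 < c) (h1 : ∀ i, 1 ≤ r i)
    (hlow : ∀ i : ℕ, c * ((i : ℝ) + 1) ≤ r i ^ 2) :
    ∀ᶠ j : ℕ in atTop, ∀ i, j ^ 12 ≤ i → 2 * (j : ℝ) ^ 4 ≤ r i ^ 2 ∧ 2 * (j : ℝ) ≤ r i := by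
  filter_upwards [tendsto_natCast_atTop_atTop.eventually_ge_atTop (4 / c), eventually_ge_atTop 1]
    with j hj hj1 i hi
  have hj1' : (1 : ℝ) ≤ j := by exact_mod_cast hj1
  have h2 : (j : ℝ) ^ 12 ≤ (i : ℝ) + 1 := by
    have : ((j ^ 12 : ℕ) : ℝ) ≤ i := by exact_mod_cast hi
    push_cast at this; linarith
  rw [div_le_iff₀ hc] at hj
  have h3 : 4 * (j : ℝ) ^ 4 ≤ r i ^ 2 := by
    calc 4 * (j : ℝ) ^ 4 ≤ (j * c) * (j : ℝ) ^ 11 := by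
          have : (j : ℝ) ^ 4 ≤ (j : ℝ) ^ 11 := pow_le_pow_right₀ hj1' (by norm_num)
          gcongr
      _ = c * (j : ℝ) ^ 12 := by ring
      _ ≤ c * ((i : ℝ) + 1) := by gcongr
      _ ≤ _ := hlow i
  have h4 : (j : ℝ) ^ 2 ≤ (j : ℝ) ^ 4 := pow_le_pow_right₀ hj1' (by norm_num)
  refine ⟨by linarith [sq_nonneg ((j : ℝ) ^ 2)], ?_⟩
  · refine le_of_sq_le_sq ?_ (by linarith [h1 i])
    nlinarith

end Moduli

/-! ### Almost sure bounds for the truncated product and the inverse power sums -/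

/-- On the unit circle ζ⁻¹ is the conjugate of ζ, so inverse power sums have the form to which the
Chernoff bound applies. -/
theorem norm_sum_one_div_pow_eq {Ω : Type*} {r : ℕ → ℝ} {θ : ℕ → Ω → ℝ} (s : Finset ℕ) (k : ℕ)
    (x : ℝ) (ω : Ω) :
    ‖∑ i ∈ s, ((x * (1 / r i ^ k) : ℝ) : ℂ) * circleMap 0 1 (θ i ω) ^ k‖
      = |x| * ‖∑ i ∈ s, 1 / ((r i : ℂ) * circleMap 0 1 (θ i ω)) ^ k‖ := by
  have h : ∑ i ∈ s, ((x * (1 / r i ^ k) : ℝ) : ℂ) * circleMap 0 1 (θ i ω) ^ k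
      = x * (starRingEnd ℂ) (∑ i ∈ s, 1 / ((r i : ℂ) * circleMap 0 1 (θ i ω)) ^ k) := by
    rw [map_sum, Finset.mul_sum]
    refine Finset.sum_congr rfl fun i _ => ?_
    have hζ : (starRingEnd ℂ) (circleMap 0 1 (θ i ω)) = (circleMap 0 1 (θ i ω))⁻¹ :=
      (Complex.inv_eq_conj (by simp)).symm
    rw [map_div₀, map_pow, map_mul, hζ, Complex.conj_ofReal, map_one, mul_pow, inv_pow]
    push_cast
    simp only [one_div, mul_inv, inv_inv]
    ring
  rw [h, norm_mul, Complex.norm_real, RCLike.norm_conj, Real.norm_eq_abs]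

section Estimates

variable {Ω : Type*} [MeasurableSpace Ω] {P : Measure Ω} {r : ℕ → ℝ} {c : ℝ} {θ : ℕ → Ω → ℝ}

theorem ae_eventually_norm_prod_le (hθ : ∀ i, Measurable (θ i)) (hi : iIndepFun θ P)
    (hu : ∀ i, pdf.IsUniform (θ i) (Set.Icc 0 (2 * Real.pi)) P volume)
    (h1 : ∀ i, 1 ≤ r i) (hc : 0 < c) (hlow : ∀ i : ℕ, c * ((i : ℝ) + 1) ≤ r i ^ 2) :
    ∃ A : ℝ, ∀ᵐ ω ∂P, ∀ᶠ j : ℕ in atTop, ∀ z : ℂ, ‖z‖ ≤ j →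
      ‖∏ i ∈ Finset.range (j ^ 12), (1 - z / ((r i : ℂ) * circleMap 0 1 (θ i ω)))‖
        ≤ Real.exp (∑ i ∈ Finset.range (j ^ 12), Real.posLog (j / r i) + A * j * Real.log j) := by
  obtain ⟨C₀, hC₀, hmean⟩ := circleAverage_norm_sub_rpow_le
  obtain ⟨C₁, hC₁, hsum⟩ := exists_sum_one_div_sq_le_log hc hlow
  set m : ℕ → ℝ := fun j => ∑ i ∈ Finset.range (j ^ 12), Real.posLog (j / r i) with hm
  set F : ℕ → ℂ → Set Ω := fun j z => {ω | Real.exp (m j + (C₀ * C₁ + 14) * j * Real.log j)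
      ≤ ‖∏ i ∈ Finset.range (j ^ 12), (1 - z / ((r i : ℂ) * circleMap 0 1 (θ i ω)))‖} with hF
  have hFm : ∀ j : ℕ, 3 ≤ j → ∀ z : ℂ, ‖z‖ = j →
      P (F j z) ≤ ENNReal.ofReal (((j : ℝ) ^ 14)⁻¹) := fun j hj z hz => by
    have hj0 : (0 : ℝ) < j := by exact_mod_cast (by omega : 0 < j)
    have hj1 : (1 : ℝ) ≤ j := by exact_mod_cast (by omega : 1 ≤ j)
    -- The exponent s = 1/j turns the second-order terms s²|z/r_i|² into 1/r_i², whose sum is O(log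
    -- j). Undoing the power costs a factor j, hence the error j log j. The deviation 14 log j
    -- leaves a total of 2/j² after the union over j¹² + 1 vertices.
    have hch := measure_exp_le_prod_le hθ hi hu (Finset.range (j ^ 12))
      (g := fun i ζ => ‖ζ - z / r i‖ ^ ((j : ℝ)⁻¹))
      (fun i => (by fun_prop : Continuous fun ζ : ℂ => ‖ζ - z / r i‖).rpow_const
        fun _ => Or.inr (by positivity))
      (fun i ζ => by positivity)
      (a := fun i => (j : ℝ)⁻¹ * Real.posLog (j / r i) + C₀ * (1 / r i ^ 2))
      (fun i _ => by
        refine (hmean (z / r i) (j : ℝ)⁻¹ (by positivity) (inv_le_one_of_one_le₀ hj1)).trans_eq ?_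
        have hri : 0 < r i := by linarith [h1 i]
        have : ‖z / (r i : ℂ)‖ = j / r i := by
          rw [norm_div, hz, Complex.norm_real, Real.norm_of_nonneg hri.le]
        rw [this]
        congr 2
        field_simp)
      (14 * Real.log j)
    have hexp : Real.exp (-(14 * Real.log j)) = ((j : ℝ) ^ 14)⁻¹ := by
      rw [Real.exp_neg, mul_comm, Real.exp_mul, Real.exp_log hj0]; norm_cast
    rw [hexp] at hch
    refine (measure_mono fun ω hω => ?_).trans hch
    simp only [hF, Set.mem_ofPred_eq] at hω ⊢
    have hprod : ∏ i ∈ Finset.range (j ^ 12),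
        ‖circleMap 0 1 (θ i ω) - z / r i‖ ^ ((j : ℝ)⁻¹)
        = ‖∏ i ∈ Finset.range (j ^ 12), (1 - z / ((r i : ℂ) * circleMap 0 1 (θ i ω)))‖
          ^ ((j : ℝ)⁻¹) := by
      rw [Real.finsetProd_rpow _ _ (fun i _ => norm_nonneg _), norm_prod]
      congr 1
      refine Finset.prod_congr rfl fun i _ => ?_
      have hζ : ‖circleMap 0 1 (θ i ω)‖ = 1 := by simp
      have hζ0 : circleMap 0 1 (θ i ω) ≠ 0 := by
        rw [← norm_pos_iff, hζ]; norm_num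
      have hri : (r i : ℂ) ≠ 0 := by
        have := h1 i
        exact_mod_cast (by linarith : (0 : ℝ) < r i).ne'
      have : circleMap 0 1 (θ i ω) - z / r i = circleMap 0 1 (θ i ω) *
          (1 - z / ((r i : ℂ) * circleMap 0 1 (θ i ω))) := by field_simp
      rw [this, norm_mul, hζ, one_mul]
    rw [hprod]
    refine le_trans ?_ (Real.rpow_le_rpow (Real.exp_pos _).le hω (by positivity))
    rw [← Real.exp_mul, Real.exp_le_exp, Finset.sum_add_distrib, ← Finset.mul_sum,
      ← Finset.mul_sum]
    have h5 := mul_le_mul_of_nonneg_left (hsum j hj) hC₀.le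
    have h6 : (m j + (C₀ * C₁ + 14) * j * Real.log j) * (j : ℝ)⁻¹
        = (j : ℝ)⁻¹ * m j + (C₀ * C₁ + 14) * Real.log j := by field_simp
    rw [h6]
    simp only [hm]
    linarith
  set ζ : ℕ → ℂ := fun j => Complex.exp (2 * Real.pi * Complex.I / ((j ^ 12 + 1 : ℕ) : ℂ)) with hζ
  have hprim : ∀ j, IsPrimitiveRoot (ζ j) (j ^ 12 + 1) := fun j =>
    Complex.isPrimitiveRoot_exp _ (by omega)
  set E : ℕ → Set Ω := fun j => ⋃ l ∈ Finset.range (j ^ 12 + 1), F j ((j : ℂ) * ζ j ^ l) with hE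
  have hEm : ∀ᶠ j in atTop, P (E j) ≤ ENNReal.ofReal (2 * (1 / (j : ℝ) ^ 2)) := by
    filter_upwards [eventually_ge_atTop 3] with j hj
    have hj1 : (1 : ℝ) ≤ j := by exact_mod_cast (by omega : 1 ≤ j)
    refine (measure_biUnion_finset_le _ _).trans ?_
    refine (Finset.sum_le_sum fun l _ => hFm j hj _ ?_).trans ?_
    · rw [norm_mul, norm_pow, (hprim j).norm'_eq_one (by omega)]; simp
    · rw [Finset.sum_const, Finset.card_range, nsmul_eq_mul, ← ENNReal.ofReal_natCast,
        ← ENNReal.ofReal_mul (by positivity)]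
      refine ENNReal.ofReal_le_ofReal ?_
      push_cast
      have : (1 : ℝ) ≤ (j : ℝ) ^ 12 := one_le_pow₀ hj1
      calc ((j : ℝ) ^ 12 + 1) * ((j : ℝ) ^ 14)⁻¹ ≤ (2 * (j : ℝ) ^ 12) * ((j : ℝ) ^ 14)⁻¹ := by
            gcongr; linarith
        _ = _ := by field_simp
  -- The 13 pays for the number of vertices, j¹² + 1 ≤ j¹³, lost in passing from the vertices to the
  -- disk.
  refine ⟨C₀ * C₁ + 14 + 13, ?_⟩
  have hsm : Summable fun j : ℕ => 2 * (1 / (j : ℝ) ^ 2) :=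
    (Real.summable_one_div_nat_pow.2 one_lt_two).mul_left 2
  filter_upwards [ae_eventually_notMem_of_summable hsm hEm] with ω hω
  filter_upwards [hω, eventually_ge_atTop 3] with j hj hj3 z hz
  have hj0 : (0 : ℝ) < j := by exact_mod_cast (by omega : 0 < j)
  have hj2 : (2 : ℝ) ≤ j := by exact_mod_cast (by omega : 2 ≤ j)
  set Q : Polynomial ℂ := ∏ i ∈ Finset.range (j ^ 12),
    (1 - Polynomial.C ((r i : ℂ) * circleMap 0 1 (θ i ω))⁻¹ * Polynomial.X) with hQ
  have hev : ∀ w, Q.eval w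
      = ∏ i ∈ Finset.range (j ^ 12), (1 - w / ((r i : ℂ) * circleMap 0 1 (θ i ω))) := fun w => by
    rw [hQ, Polynomial.eval_prod]
    refine Finset.prod_congr rfl fun i _ => ?_
    simp only [Polynomial.eval_sub, Polynomial.eval_one, Polynomial.eval_mul, Polynomial.eval_C,
      Polynomial.eval_X]
    rw [div_eq_inv_mul]
  have hdeg : Q.natDegree < j ^ 12 + 1 := by
    rw [Nat.lt_succ_iff]
    refine (Polynomial.natDegree_prod_le _ _).trans ?_
    refine (Finset.sum_le_card_nsmul _ _ 1 fun i _ => ?_).trans (by simp)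
    refine (Polynomial.natDegree_sub_le _ _).trans ?_
    simp only [Polynomial.natDegree_one]
    refine max_le (by omega) ((Polynomial.natDegree_C_mul_le _ _).trans Polynomial.natDegree_X_le)
  have hbd : ∀ l < j ^ 12 + 1, ‖Q.eval (((j : ℝ) : ℂ) * ζ j ^ l)‖
      ≤ Real.exp (m j + (C₀ * C₁ + 14) * j * Real.log j) := fun l hl => by
    by_contra hcon
    refine hj (Set.mem_biUnion (Finset.mem_coe.2 (Finset.mem_range.2 hl)) ?_)
    simp only [hF, Set.mem_ofPred_eq]
    rw [hev] at hcon
    push_cast at hcon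
    exact (not_le.1 hcon).le
  have := Polynomial.norm_eval_le_of_norm_eval_le_on_rootsOfUnity (hprim j) (by omega) hdeg
    hj0.le hbd hz
  rw [hev] at this
  refine this.trans ?_
  have hL : ((j ^ 12 + 1 : ℕ) : ℝ) ≤ Real.exp (13 * j * Real.log j) := by
    have h7 : (1 : ℝ) ≤ (j : ℝ) ^ 12 := one_le_pow₀ (by linarith)
    have hlog : 0 ≤ Real.log j := Real.log_nonneg (by linarith)
    calc ((j ^ 12 + 1 : ℕ) : ℝ) ≤ (j : ℝ) ^ 13 := by
          push_cast; rw [pow_succ (j : ℝ) 12]; nlinarith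
      _ = Real.exp (13 * Real.log j) := by
          rw [mul_comm, Real.exp_mul, Real.exp_log hj0]; norm_cast
      _ ≤ _ := by
          rw [Real.exp_le_exp]
          nlinarith
  calc _ ≤ Real.exp (13 * j * Real.log j) * Real.exp (m j + (C₀ * C₁ + 14) * j * Real.log j) := by
        gcongr
    _ = _ := by rw [← Real.exp_add]; congr 1; ring

theorem ae_eventually_norm_sum_inv_le (hθ : ∀ i, Measurable (θ i)) (hi : iIndepFun θ P)
    (hu : ∀ i, pdf.IsUniform (θ i) (Set.Icc 0 (2 * Real.pi)) P volume)
    (h1 : ∀ i, 1 ≤ r i) (hc : 0 < c) (hlow : ∀ i : ℕ, c * ((i : ℝ) + 1) ≤ r i ^ 2) :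
    ∃ A : ℝ, ∀ᵐ ω ∂P, ∀ᶠ j : ℕ in atTop,
      ‖∑ i ∈ Finset.range (j ^ 12), 1 / ((r i : ℂ) * circleMap 0 1 (θ i ω))‖
        ≤ A * Real.log j := by
  obtain ⟨C₁, hC₁, hsum⟩ := exists_sum_one_div_sq_le_log hc hlow
  refine ⟨2 * (C₁ + 2), ?_⟩
  have hsm : Summable fun j : ℕ => 4 * (1 / (j : ℝ) ^ 2) :=
    (Real.summable_one_div_nat_pow.2 one_lt_two).mul_left 4
  have hE : ∀ᶠ j : ℕ in atTop, P {ω | 2 * (C₁ + 2) * Real.log j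
      < ‖∑ i ∈ Finset.range (j ^ 12), 1 / ((r i : ℂ) * circleMap 0 1 (θ i ω))‖}
      ≤ ENNReal.ofReal (4 * (1 / (j : ℝ) ^ 2)) := by
    filter_upwards [eventually_ge_atTop 3] with j hj
    have hj0 : (0 : ℝ) < j := by exact_mod_cast (by omega : 0 < j)
    have hd : ∀ i, ‖((1 * (1 / r i ^ 1) : ℝ) : ℂ)‖ = 1 / r i := fun i => by
      have := h1 i
      rw [Complex.norm_real, one_mul, pow_one, Real.norm_of_nonneg (by positivity)]
    have h := measure_le_norm_sum_le hθ hi hu (Finset.range (j ^ 12)) (k := 1) one_ne_zero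
      (fun i => ((1 * (1 / r i ^ 1) : ℝ) : ℂ)) (fun i _ => by
        rw [hd]
        exact (div_le_one (by linarith [h1 i])).2 (h1 i)) (2 * Real.log j)
    have hexp : Real.exp (-(2 * Real.log j)) = 1 / (j : ℝ) ^ 2 := by
      rw [Real.exp_neg, mul_comm, Real.exp_mul, Real.exp_log hj0, one_div]; norm_cast
    rw [hexp] at h
    refine (measure_mono fun ω hω => ?_).trans h
    simp only [Set.mem_ofPred_eq] at hω ⊢
    rw [norm_sum_one_div_pow_eq, abs_one, one_mul]
    simp only [pow_one]
    refine le_trans ?_ hω.le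
    have h5 := hsum j hj
    simp only [pow_one] at hd
    simp only [hd, div_pow, one_pow]
    linarith
  filter_upwards [ae_eventually_notMem_of_summable hsm hE] with ω hω
  filter_upwards [hω] with j hj
  exact not_lt.1 hj

/-- Each block between j¹² and (j+1)¹² contributes at most j⁻³ outside an event of probability 4/j²,
so the partial sums converge at rate 1/j. -/
theorem ae_eventually_norm_sum_inv_sq_le (hθ : ∀ i, Measurable (θ i)) (hi : iIndepFun θ P)
    (hu : ∀ i, pdf.IsUniform (θ i) (Set.Icc 0 (2 * Real.pi)) P volume)
    (h1 : ∀ i, 1 ≤ r i) (hc : 0 < c) (hlow : ∀ i : ℕ, c * ((i : ℝ) + 1) ≤ r i ^ 2) :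
    ∀ᵐ ω ∂P, ∃ C : ℂ, ∃ K : ℝ, ∀ᶠ j : ℕ in atTop,
      ‖C - ∑ i ∈ Finset.range (j ^ 12), 1 / ((r i : ℂ) * circleMap 0 1 (θ i ω)) ^ 2‖
        ≤ K / j := by
  have hsm : Summable fun j : ℕ => 4 * (1 / (j : ℝ) ^ 2) :=
    (Real.summable_one_div_nat_pow.2 one_lt_two).mul_left 4
  set B := (c ^ 2)⁻¹ * ∑' i : ℕ, ((i : ℝ) + 1) ^ (-(5 / 4) : ℝ) with hB
  have hlogj : ∀ᶠ j : ℕ in atTop, 2 * (B + 2 * Real.log j) ≤ j := by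
    have h0 : Tendsto (fun x : ℝ => (2 * B) / x + 4 * (Real.log x / x)) atTop (𝓝 0) := by
      have hl := (Real.isLittleO_log_id_atTop).tendsto_div_nhds_zero
      simpa using (tendsto_const_nhds.div_atTop tendsto_id).add (hl.const_mul 4)
    have h2 := (h0.comp tendsto_natCast_atTop_atTop).eventually_le_const one_pos
    filter_upwards [h2, eventually_gt_atTop 0] with j hj hj0
    have hj0 : (0 : ℝ) < j := by exact_mod_cast hj0
    simp only [Function.comp_apply] at hj
    have := mul_le_mul_of_nonneg_right hj hj0.le
    have e : (2 * B / j + 4 * (Real.log j / j)) * j = 2 * (B + 2 * Real.log j) := by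
      field_simp; ring
    rwa [e, one_mul] at this
  have hE : ∀ᶠ j : ℕ in atTop, P {ω | 1 / (j : ℝ) ^ 3
      < ‖∑ i ∈ Finset.Ico (j ^ 12) ((j + 1) ^ 12),
        1 / ((r i : ℂ) * circleMap 0 1 (θ i ω)) ^ 2‖}
      ≤ ENNReal.ofReal (4 * (1 / (j : ℝ) ^ 2)) := by
    filter_upwards [hlogj, eventually_gt_atTop 0, eventually_two_mul_le_apply hc h1 hlow]
      with j hlj hj hbig
    have hj0 : (0 : ℝ) < j := by exact_mod_cast hj
    -- Scaled by j⁴, the coefficients stay below 1 and their squares sum to at most B. The scaled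
    -- block is then O(log j) ≤ j, that is, at most j⁻³ before scaling.
    have hd : ∀ i, ‖(((j : ℝ) ^ 4 * (1 / r i ^ 2) : ℝ) : ℂ)‖ = (j : ℝ) ^ 4 * (1 / r i ^ 2) :=
      fun i => by
        rw [Complex.norm_real, Real.norm_of_nonneg (by positivity)]
    have h := measure_le_norm_sum_le hθ hi hu (Finset.Ico (j ^ 12) ((j + 1) ^ 12))
      (k := 2) two_ne_zero
      (fun i => (((j : ℝ) ^ 4 * (1 / r i ^ 2) : ℝ) : ℂ)) (fun i hi => by
        rw [hd, mul_one_div]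
        refine div_le_one_of_le₀ ?_ (sq_nonneg _)
        have := (hbig i (Finset.mem_Ico.1 hi).1).1
        have : 0 ≤ (j : ℝ) ^ 4 := by positivity
        linarith) (2 * Real.log j)
    have hexp : Real.exp (-(2 * Real.log j)) = 1 / (j : ℝ) ^ 2 := by
      rw [Real.exp_neg, mul_comm, Real.exp_mul, Real.exp_log hj0, one_div]; norm_cast
    rw [hexp] at h
    refine (measure_mono fun ω hω => ?_).trans h
    simp only [Set.mem_ofPred_eq] at hω ⊢
    rw [norm_sum_one_div_pow_eq]
    simp only [hd]
    have hBs : ∑ i ∈ Finset.Ico (j ^ 12) ((j + 1) ^ 12), ((j : ℝ) ^ 4 * (1 / r i ^ 2)) ^ 2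
        ≤ B := by
      calc _ ≤ ∑ i ∈ Finset.Ico (j ^ 12) ((j + 1) ^ 12),
            (c ^ 2)⁻¹ * ((i : ℝ) + 1) ^ (-(5 / 4) : ℝ) := Finset.sum_le_sum fun i hi => by
              refine le_trans ?_ (pow_mul_one_div_pow_four_le hc hlow (Finset.mem_Ico.1 hi).1)
              rw [mul_pow, ← pow_mul]
              gcongr
              · exact_mod_cast hj
              · norm_num
        _ = (c ^ 2)⁻¹ * ∑ i ∈ Finset.Ico (j ^ 12) ((j + 1) ^ 12),
            ((i : ℝ) + 1) ^ (-(5 / 4) : ℝ) := by rw [Finset.mul_sum]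
        _ ≤ _ := by
            rw [hB]
            gcongr
            exact summable_succ_rpow.sum_le_tsum _ fun i _ => by positivity
    calc _ ≤ 2 * (B + 2 * Real.log j) := by gcongr
      _ ≤ j := hlj
      _ = |(j : ℝ) ^ 4| * (1 / (j : ℝ) ^ 3) := by
          rw [abs_of_pos (by positivity)]; field_simp
      _ ≤ _ := by gcongr
  filter_upwards [ae_eventually_notMem_of_summable hsm hE] with ω hω
  refine exists_forall_norm_sub_le_div (C := fun j => ∑ i ∈ Finset.range (j ^ 12),
    1 / ((r i : ℂ) * circleMap 0 1 (θ i ω)) ^ 2) ?_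
  filter_upwards [hω] with j hj
  rw [← Finset.sum_Ico_eq_sub _ (Nat.pow_le_pow_left (Nat.le_succ j) 12)]
  exact not_lt.1 hj

end Estimates

/-! ### The canonical product: factorization, zeros and size -/

/-- The logarithm of the Weierstrass elementary factor of genus two. -/
noncomputable def logElementaryFactor (w : ℂ) : ℂ := Complex.log (1 - w) + w + w ^ 2 / 2

theorem norm_logElementaryFactor_le {w : ℂ} (hw : ‖w‖ ≤ 1 / 2) :
    ‖logElementaryFactor w‖ ≤ ‖w‖ ^ 3 := by
  have h := Complex.norm_log_sub_logTaylor_le 2 (z := -w) (by rw [norm_neg]; linarith)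
  have e : Complex.log (1 + -w) - Complex.logTaylor (2 + 1) (-w) = logElementaryFactor w := by
    simp only [Complex.logTaylor_succ, Complex.logTaylor_zero, logElementaryFactor, Pi.add_apply]
    norm_num
    ring_nf
  rw [e, norm_neg] at h
  refine h.trans ?_
  have h2 : (1 - ‖w‖)⁻¹ ≤ 2 := by
    rw [inv_le_iff_one_le_mul₀ (by linarith)]; linarith
  have h3 : 0 ≤ ‖w‖ ^ 3 := by positivity
  norm_num
  rw [div_le_iff₀ (by norm_num)]
  nlinarith

theorem exp_logElementaryFactor {w : ℂ} (hw : w ≠ 1) :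
    Complex.exp (logElementaryFactor w) = (1 - w) * Complex.exp (w + w ^ 2 / 2) := by
  rw [logElementaryFactor, add_assoc, Complex.exp_add, Complex.exp_log (sub_ne_zero.2 hw.symm)]

theorem differentiableAt_logElementaryFactor {w : ℂ} (hw : ‖w‖ < 1) :
    DifferentiableAt ℂ logElementaryFactor w := by
  have : (1 - w) ∈ Complex.slitPlane := by
    rw [sub_eq_add_neg]
    exact Complex.mem_slitPlane_of_norm_lt_one (by rwa [norm_neg])
  unfold logElementaryFactor
  fun_prop (disch := assumption)

/-- The canonical product of genus two with zeros `z`, times the factor `exp (-C x ^ 2 / 2)`. -/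
noncomputable def canonicalProduct (C : ℂ) (z : ℕ → ℂ) (x : ℂ) : ℂ :=
  Complex.exp (-C * x ^ 2 / 2)
    * ∏' i, (1 - x / z i) * Complex.exp (x / z i + (x / z i) ^ 2 / 2)

/-- The exponent by which `canonicalProduct` differs from the product of its first `M` linear
factors. -/
noncomputable def productExponent (C : ℂ) (z : ℕ → ℂ) (M : ℕ) (x : ℂ) : ℂ :=
  x * ∑ i ∈ Finset.range M, 1 / z i
    - x ^ 2 / 2 * (C - ∑ i ∈ Finset.range M, 1 / z i ^ 2)
    + ∑' i, logElementaryFactor (x / z (i + M))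

section Product

variable {z : ℕ → ℂ} {C : ℂ}

theorem norm_div_le_half {M : ℕ} {ρ : ℝ} (h1 : ∀ i, 1 ≤ ‖z i‖)
    (hM : ∀ i, M ≤ i → 2 * ρ ≤ ‖z i‖) {x : ℂ} (hx : ‖x‖ ≤ ρ) (i : ℕ) :
    ‖x / z (i + M)‖ ≤ 1 / 2 := by
  rw [norm_div, div_le_iff₀ (by linarith [h1 (i + M)])]
  linarith [hM (i + M) (by omega)]

theorem norm_logElementaryFactor_div_le {M : ℕ} {ρ : ℝ} (h1 : ∀ i, 1 ≤ ‖z i‖)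
    (hM : ∀ i, M ≤ i → 2 * ρ ≤ ‖z i‖) {x : ℂ} (hx : ‖x‖ ≤ ρ) (i : ℕ) :
    ‖logElementaryFactor (x / z (i + M))‖ ≤ ρ ^ 3 * (1 / ‖z (i + M)‖) ^ 3 := by
  refine (norm_logElementaryFactor_le (norm_div_le_half h1 hM hx i)).trans ?_
  rw [norm_div, div_eq_mul_one_div, mul_pow]
  gcongr

/-- On the disk the factors from M on are exponentials of a summable series. The exponential parts
of the first M factors are moved into the exponent, leaving bare linear factors. -/
theorem canonicalProduct_eq {M : ℕ} {ρ : ℝ} (h1 : ∀ i, 1 ≤ ‖z i‖)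
    (hs : Summable fun i => (1 / ‖z i‖) ^ 3) (hM : ∀ i, M ≤ i → 2 * ρ ≤ ‖z i‖)
    {x : ℂ} (hx : ‖x‖ ≤ ρ) :
    canonicalProduct C z x
      = (∏ i ∈ Finset.range M, (1 - x / z i)) * Complex.exp (productExponent C z M x) := by
  have hsum : Summable fun i => logElementaryFactor (x / z (i + M)) :=
    Summable.of_norm_bounded (((summable_nat_add_iff M).2 hs).mul_left (ρ ^ 3))
      (norm_logElementaryFactor_div_le h1 hM hx)
  have htail : HasProd (fun i => (1 - x / z (i + M))
      * Complex.exp (x / z (i + M) + (x / z (i + M)) ^ 2 / 2))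
      (Complex.exp (∑' i, logElementaryFactor (x / z (i + M)))) := by
    convert hsum.hasSum.cexp using 1
    funext i
    rw [Function.comp_apply, exp_logElementaryFactor]
    intro h
    have := norm_div_le_half h1 hM hx i
    rw [h] at this
    norm_num at this
  have hprod := (HasProd.prod_range_mul
    (f := fun i => (1 - x / z i) * Complex.exp (x / z i + (x / z i) ^ 2 / 2)) htail).tprod_eq
  rw [canonicalProduct, hprod, Finset.prod_mul_distrib, ← Complex.exp_sum, productExponent,
    Finset.sum_add_distrib]
  have e1 : ∑ i ∈ Finset.range M, x / z i = x * ∑ i ∈ Finset.range M, 1 / z i := by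
    rw [Finset.mul_sum]
    exact Finset.sum_congr rfl fun i _ => by ring
  have e2 : ∑ i ∈ Finset.range M, (x / z i) ^ 2 / 2
      = x ^ 2 / 2 * ∑ i ∈ Finset.range M, 1 / z i ^ 2 := by
    rw [Finset.mul_sum]
    exact Finset.sum_congr rfl fun i _ => by ring
  rw [e1, e2, mul_assoc, mul_left_comm, ← Complex.exp_add, ← Complex.exp_add]
  congr 2
  ring

theorem differentiableOn_productExponent {M : ℕ} {ρ : ℝ} (h1 : ∀ i, 1 ≤ ‖z i‖)
    (hs : Summable fun i => (1 / ‖z i‖) ^ 3) (hM : ∀ i, M ≤ i → 2 * ρ ≤ ‖z i‖) :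
    DifferentiableOn ℂ (productExponent C z M) (Metric.ball 0 ρ) := by
  have ht : DifferentiableOn ℂ (fun x => ∑' i, logElementaryFactor (x / z (i + M)))
      (Metric.ball 0 ρ) := by
    refine Complex.differentiableOn_tsum_of_summable_norm
      (((summable_nat_add_iff M).2 hs).mul_left (ρ ^ 3)) (fun i x hx => ?_) Metric.isOpen_ball
      fun i x hx => norm_logElementaryFactor_div_le h1 hM (mem_ball_zero_iff.1 hx).le i
    have hx' := norm_div_le_half h1 hM (mem_ball_zero_iff.1 hx).le i
    have hd := differentiableAt_logElementaryFactor (w := x / z (i + M)) (by linarith)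
    have hdiv : DifferentiableAt ℂ (fun y => y / z (i + M)) x := by fun_prop
    exact (hd.comp x hdiv).differentiableWithinAt
  unfold productExponent
  fun_prop

theorem exists_forall_two_mul_le (htop : Tendsto (fun i => ‖z i‖) atTop atTop) (ρ : ℝ) :
    ∃ M : ℕ, ∀ i, M ≤ i → 2 * ρ ≤ ‖z i‖ :=
  eventually_atTop.1 (htop.eventually_ge_atTop (2 * ρ))

theorem canonicalProduct_eventuallyEq (h1 : ∀ i, 1 ≤ ‖z i‖)
    (hs : Summable fun i => (1 / ‖z i‖) ^ 3) {M : ℕ} {w : ℂ}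
    (hM : ∀ i, M ≤ i → 2 * (‖w‖ + 1) ≤ ‖z i‖) :
    canonicalProduct C z =ᶠ[𝓝 w] (fun x => ∏ i ∈ Finset.range M, (1 - x / z i))
      * fun x => Complex.exp (productExponent C z M x) := by
  have : Metric.ball (0 : ℂ) (‖w‖ + 1) ∈ 𝓝 w :=
    Metric.isOpen_ball.mem_nhds (mem_ball_zero_iff.2 (by linarith))
  filter_upwards [this] with x hx
  exact canonicalProduct_eq h1 hs hM (mem_ball_zero_iff.1 hx).le

theorem analyticAt_exp_productExponent (h1 : ∀ i, 1 ≤ ‖z i‖)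
    (hs : Summable fun i => (1 / ‖z i‖) ^ 3) {M : ℕ} {w : ℂ}
    (hM : ∀ i, M ≤ i → 2 * (‖w‖ + 1) ≤ ‖z i‖) :
    AnalyticAt ℂ (fun x => Complex.exp (productExponent C z M x)) w :=
  ((differentiableOn_productExponent h1 hs hM).analyticAt
    (Metric.isOpen_ball.mem_nhds (mem_ball_zero_iff.2 (by linarith)))).cexp

theorem differentiable_canonicalProduct (h1 : ∀ i, 1 ≤ ‖z i‖)
    (hs : Summable fun i => (1 / ‖z i‖) ^ 3) (htop : Tendsto (fun i => ‖z i‖) atTop atTop) :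
    Differentiable ℂ (canonicalProduct C z) := fun w => by
  obtain ⟨M, hM⟩ := exists_forall_two_mul_le htop (‖w‖ + 1)
  refine DifferentiableAt.congr_of_eventuallyEq ?_ (canonicalProduct_eventuallyEq h1 hs hM)
  refine DifferentiableAt.mul ?_ (analyticAt_exp_productExponent h1 hs hM).differentiableAt
  fun_prop

open Classical in
theorem analyticOrderAt_prod_one_sub_div (h1 : ∀ i, 1 ≤ ‖z i‖) (s : Finset ℕ) (w : ℂ) :
    analyticOrderAt (fun x => ∏ i ∈ s, (1 - x / z i)) w = {i ∈ s | z i = w}.card := by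
  induction s using Finset.induction_on with
  | empty => simp [analyticOrderAt_eq_zero]
  | insert a s ha ih =>
    have hz : z a ≠ 0 := norm_pos_iff.1 (by linarith [h1 a])
    have hfun : (fun x => ∏ i ∈ insert a s, (1 - x / z i))
        = (fun x => 1 - x / z a) * fun x => ∏ i ∈ s, (1 - x / z i) := by
      funext x
      simp [Finset.prod_insert ha]
    have hA : AnalyticAt ℂ (fun x => 1 - x / z a) w :=
      Differentiable.analyticAt (by fun_prop) w
    rw [hfun, analyticOrderAt_mul hA (Differentiable.analyticAt (by fun_prop) w), ih,
      Finset.filter_insert]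
    by_cases h : z a = w
    · rw [if_pos h, Finset.card_insert_of_notMem (by simp [ha])]
      have hw : w ≠ 0 := h ▸ hz
      have hd : deriv (fun x => 1 - x / z a) w ≠ 0 := by
        simp [hz]
      have := hA.analyticOrderAt_sub_eq_one_of_deriv_ne_zero hd
      simp only [h, div_self hw, sub_self, sub_zero] at this ⊢
      rw [this]
      push_cast
      ring
    · rw [if_neg h, hA.analyticOrderAt_eq_zero.2, zero_add]
      rw [sub_ne_zero, Ne, eq_comm, div_eq_one_iff_eq hz]
      exact fun h' => h h'.symm

/-- Near w the function is a finite product times a zero-free exponential, and the indices left out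
have |z_i| ≥ 2(|w| + 1), so none of them equals w. -/
theorem analyticOrderAt_canonicalProduct (h1 : ∀ i, 1 ≤ ‖z i‖)
    (hs : Summable fun i => (1 / ‖z i‖) ^ 3) (htop : Tendsto (fun i => ‖z i‖) atTop atTop)
    (w : ℂ) : analyticOrderAt (canonicalProduct C z) w = {i | z i = w}.encard := by
  classical
  obtain ⟨M, hM⟩ := exists_forall_two_mul_le htop (‖w‖ + 1)
  have hE := analyticAt_exp_productExponent (C := C) h1 hs hM
  rw [analyticOrderAt_congr (canonicalProduct_eventuallyEq h1 hs hM),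
    analyticOrderAt_mul (Differentiable.analyticAt (by fun_prop) w) hE,
    hE.analyticOrderAt_eq_zero.2 (Complex.exp_ne_zero _), add_zero,
    analyticOrderAt_prod_one_sub_div h1, ← Set.encard_coe_eq_coe_finsetCard]
  congr 1
  ext i
  simp only [Finset.coe_filter, Finset.mem_range, Set.mem_ofPred_eq, and_iff_right_iff_imp]
  intro hi
  by_contra hcon
  have := hM i (not_lt.1 hcon)
  rw [hi] at this
  linarith [norm_nonneg w]

theorem canonicalProduct_zero : canonicalProduct C z 0 = 1 := by
  simp [canonicalProduct]

theorem norm_exp_productExponent_le {M : ℕ} {ρ S T B : ℝ} (h1 : ∀ i, 1 ≤ ‖z i‖)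
    (hs : Summable fun i => (1 / ‖z i‖) ^ 3) (hM : ∀ i, M ≤ i → 2 * ρ ≤ ‖z i‖)
    (hS : ‖∑ i ∈ Finset.range M, 1 / z i‖ ≤ S)
    (hT : ‖C - ∑ i ∈ Finset.range M, 1 / z i ^ 2‖ ≤ T)
    (hB : ∑' i, ρ ^ 3 * (1 / ‖z (i + M)‖) ^ 3 ≤ B) {x : ℂ} (hx : ‖x‖ ≤ ρ) :
    ‖Complex.exp (productExponent C z M x)‖ ≤ Real.exp (ρ * S + ρ ^ 2 / 2 * T + B) := by
  rw [Complex.norm_exp, Real.exp_le_exp]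
  refine (Complex.re_le_norm _).trans ?_
  have hρ : 0 ≤ ρ := (norm_nonneg x).trans hx
  have htail : ‖∑' i, logElementaryFactor (x / z (i + M))‖ ≤ B :=
    (tsum_of_norm_bounded (((summable_nat_add_iff M).2 hs).mul_left (ρ ^ 3)).hasSum
      (norm_logElementaryFactor_div_le h1 hM hx)).trans hB
  unfold productExponent
  refine (norm_add_le _ _).trans (add_le_add ((norm_sub_le _ _).trans (add_le_add ?_ ?_)) htail)
  · rw [norm_mul]
    gcongr
  · rw [norm_mul, norm_div, norm_pow, Complex.norm_ofNat]
    gcongr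

end Product

/-! ### Almost sure growth of the canonical product -/

section Growth

variable {Ω : Type*} [MeasurableSpace Ω] {P : Measure Ω} {r : ℕ → ℝ} {c : ℝ} {θ : ℕ → Ω → ℝ}

theorem summable_one_div_pow_three (hc : 0 < c) (h1 : ∀ i, 1 ≤ r i)
    (hlow : ∀ i : ℕ, c * ((i : ℝ) + 1) ≤ r i ^ 2) : Summable fun i => (1 / r i) ^ 3 := by
  refine Summable.of_norm_bounded_eventually_nat
    (summable_succ_rpow.mul_left (c ^ (3 / 2 : ℝ))⁻¹) ?_
  filter_upwards [eventually_ge_atTop 1] with i hi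
  have := h1 i
  rw [Real.norm_of_nonneg (by positivity)]
  simpa using pow_mul_one_div_pow_three_le hc h1 hlow (i := i) (j := 1) (by simpa using hi)

theorem tsum_pow_three_mul_le (hc : 0 < c) (h1 : ∀ i, 1 ≤ r i)
    (hlow : ∀ i : ℕ, c * ((i : ℝ) + 1) ≤ r i ^ 2) {j M : ℕ} (hM : j ^ 12 ≤ M) :
    ∑' i, (j : ℝ) ^ 3 * (1 / r (i + M)) ^ 3
      ≤ ∑' i : ℕ, (c ^ (3 / 2 : ℝ))⁻¹ * ((i : ℝ) + 1) ^ (-(5 / 4) : ℝ) := by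
  have hs := summable_succ_rpow.mul_left (c ^ (3 / 2 : ℝ))⁻¹
  have h0 : ∀ i : ℕ, 0 ≤ (c ^ (3 / 2 : ℝ))⁻¹ * ((i : ℝ) + 1) ^ (-(5 / 4) : ℝ) := fun i => by
    positivity
  calc _ ≤ ∑' i : ℕ, (c ^ (3 / 2 : ℝ))⁻¹ * (((i + M : ℕ) : ℝ) + 1) ^ (-(5 / 4) : ℝ) :=
        Summable.tsum_le_tsum
          (fun i => pow_mul_one_div_pow_three_le hc h1 hlow (hM.trans (Nat.le_add_left _ _)))
          (((summable_nat_add_iff M).2 (summable_one_div_pow_three hc h1 hlow)).mul_left _)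
          ((summable_nat_add_iff M).2 hs)
    _ ≤ _ := by
        rw [← hs.sum_add_tsum_nat_add M]
        exact le_add_of_nonneg_left (Finset.sum_nonneg fun i _ => h0 i)

theorem ae_exists_norm_canonicalProduct_le (hθ : ∀ i, Measurable (θ i)) (hi : iIndepFun θ P)
    (hu : ∀ i, pdf.IsUniform (θ i) (Set.Icc 0 (2 * Real.pi)) P volume)
    (hr : StrictMono r) (h1 : ∀ i, 1 ≤ r i) (hc : 0 < c)
    (hlow : ∀ i : ℕ, c * ((i : ℝ) + 1) ≤ r i ^ 2)
    (hlim : Tendsto (fun i : ℕ => r i ^ 2 / ((i : ℝ) + 1)) atTop (𝓝 1))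
    (hgrow : ∀ K : ℝ, ∀ᶠ i : ℕ in atTop,
      ((i : ℝ) + 1) + K * √((i : ℝ) + 1) * Real.log ((i : ℝ) + 1) ≤ r i ^ 2) :
    ∀ᵐ ω ∂P, ∃ C : ℂ, ∃ R : ℝ, ∀ x : ℂ, R ≤ ‖x‖ →
      ‖canonicalProduct C (fun i => (r i : ℂ) * circleMap 0 1 (θ i ω)) x‖
        ≤ Real.exp (‖x‖ ^ 2 / 2 - ‖x‖) := by
  obtain ⟨A₁, hA₁⟩ := ae_eventually_norm_prod_le hθ hi hu h1 hc hlow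
  obtain ⟨A₂, hA₂⟩ := ae_eventually_norm_sum_inv_le hθ hi hu h1 hc hlow
  filter_upwards [hA₁, hA₂, ae_eventually_norm_sum_inv_sq_le hθ hi hu h1 hc hlow]
    with ω hω₁ hω₂ ⟨C, K, hω₃⟩
  refine ⟨C, ?_⟩
  set z : ℕ → ℂ := fun i => (r i : ℂ) * circleMap 0 1 (θ i ω) with hz
  have hzn : ∀ i, ‖z i‖ = r i := fun i => by
    simp only [hz]
    rw [norm_mul, Complex.norm_real, Real.norm_of_nonneg (by linarith [h1 i])]
    simp
  have hz1 : ∀ i, 1 ≤ ‖z i‖ := fun i => (hzn i).symm ▸ h1 i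
  have hzs : Summable fun i => (1 / ‖z i‖) ^ 3 := by
    simpa only [hzn] using summable_one_div_pow_three hc h1 hlow
  set B := ∑' i : ℕ, (c ^ (3 / 2 : ℝ))⁻¹ * ((i : ℝ) + 1) ^ (-(5 / 4) : ℝ) with hB
  have hmean := tendsto_natCast_atTop_atTop.eventually
    -- The gain is taken large enough to cancel all four losses and still leave 3 j log j ≥ 3j.
    (eventually_sum_posLog_le hr h1 hlim hgrow (A₁ + A₂ + |K| + |B| + 3))
  have hkey : ∀ᶠ j : ℕ in atTop, ∀ x : ℂ, ‖x‖ ≤ j →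
      ‖canonicalProduct C z x‖ ≤ Real.exp ((j : ℝ) ^ 2 / 2 - 3 * j) := by
    filter_upwards [hω₁, hω₂, hω₃, hmean, eventually_two_mul_le_apply hc h1 hlow,
      eventually_ge_atTop 3] with j e1 e2 e3 e4 e5 hj x hx
    have hj3 : (3 : ℝ) ≤ j := by exact_mod_cast hj
    have hlog : 1 ≤ Real.log j := by
      rw [Real.le_log_iff_exp_le (by positivity)]
      linarith [Real.exp_one_lt_d9]
    have hM : ∀ i, j ^ 12 ≤ i → 2 * (j : ℝ) ≤ ‖z i‖ := fun i hi => (hzn i).symm ▸ (e5 i hi).2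
    rw [canonicalProduct_eq hz1 hzs hM hx, norm_mul]
    have hB' : ∑' i, (j : ℝ) ^ 3 * (1 / ‖z (i + j ^ 12)‖) ^ 3 ≤ B := by
      simpa only [hzn] using tsum_pow_three_mul_le hc h1 hlow (le_refl (j ^ 12))
    refine (mul_le_mul (e1 x hx) (norm_exp_productExponent_le hz1 hzs hM e2 e3 hB' hx)
      (norm_nonneg _) (Real.exp_pos _).le).trans ?_
    rw [← Real.exp_add, Real.exp_le_exp]
    have hK : (j : ℝ) ^ 2 / 2 * (K / j) = j * K / 2 := by field_simp
    rw [hK]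
    have hjl : (j : ℝ) ≤ j * Real.log j := le_mul_of_one_le_right (by linarith) hlog
    have f1 : (j : ℝ) * K / 2 ≤ |K| * (j * Real.log j) := by
      have : K ≤ |K| := le_abs_self K
      have h0 : 0 ≤ |K| := abs_nonneg K
      nlinarith
    have f2 : B ≤ |B| * (j * Real.log j) := by
      have : B ≤ |B| := le_abs_self B
      have h0 : 0 ≤ |B| := abs_nonneg B
      nlinarith
    have := e4 (j ^ 12)
    nlinarith
  obtain ⟨J, hJ⟩ := eventually_atTop.1 hkey
  refine ⟨J + 1, fun x hx => ?_⟩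
  have hJ0 : (0 : ℝ) ≤ J := Nat.cast_nonneg J
  have hceil : (⌈‖x‖⌉₊ : ℝ) < ‖x‖ + 1 := Nat.ceil_lt_add_one (norm_nonneg x)
  have hceil2 : ‖x‖ ≤ ⌈‖x‖⌉₊ := Nat.le_ceil _
  have hJle : J ≤ ⌈‖x‖⌉₊ := by
    have : (J : ℝ) ≤ ⌈‖x‖⌉₊ := by linarith
    exact_mod_cast this
  refine (hJ _ hJle x hceil2).trans (Real.exp_le_exp.2 ?_)
  -- Rounding |x| up to j adds at most |x| + 1/2 to j²/2. The reserve of 3j ≥ 3|x| covers this and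
  -- the claimed |x|, as |x| ≥ 1.
  nlinarith

end Growth

/-! ### Membership in the Fock spaces -/

/-- The gain |x| in the exponent bounds the integrand by exp(-p|x|) near infinity, which is O((1 +
|x|)⁻³) and so integrable in the plane. -/
theorem mem_fockSpace_classicalWeight {f : ℂ → ℂ} (hf : Differentiable ℂ f) {R : ℝ}
    (hR : ∀ x : ℂ, R ≤ ‖x‖ → ‖f x‖ ≤ Real.exp (‖x‖ ^ 2 / 2 - ‖x‖)) {p : ℝ} (hp : 0 < p) :
    f ∈ FockSpace classicalWeight p := by
  refine ⟨hf, ?_⟩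
  have hcont : Continuous fun z : ℂ => ‖f z‖ ^ p * Real.exp (-p * classicalWeight ‖z‖) := by
    unfold classicalWeight
    have := hf.continuous
    exact (this.norm.rpow_const fun _ => Or.inr hp.le).mul (by fun_prop)
  have hint : Integrable (fun z : ℂ => (1 + ‖z‖) ^ (-3 : ℝ)) :=
    integrable_one_add_norm (by rw [Complex.finrank_real_complex]; norm_num)
  refine hcont.locallyIntegrable.integrable_of_isBigO_cocompact ?_ (hint.integrableAtFilter _)
  have hnorm : Tendsto (fun z : ℂ => ‖z‖) (cocompact ℂ) atTop := tendsto_norm_cocompact_atTop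
  have h1 : (fun z : ℂ => ‖f z‖ ^ p * Real.exp (-p * classicalWeight ‖z‖))
      =O[cocompact ℂ] fun z => Real.exp (-p * ‖z‖) := by
    refine IsBigO.of_bound 1 ?_
    filter_upwards [hnorm.eventually_ge_atTop R] with z hz
    rw [one_mul, Real.norm_of_nonneg (by positivity), Real.norm_of_nonneg (Real.exp_pos _).le]
    calc _ ≤ Real.exp (‖z‖ ^ 2 / 2 - ‖z‖) ^ p * Real.exp (-p * classicalWeight ‖z‖) := by
          gcongr
          exact hR z hz
      _ = _ := by
          rw [← Real.exp_mul, ← Real.exp_add, classicalWeight]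
          congr 1; ring
  have h2 : (fun z : ℂ => Real.exp (-p * ‖z‖)) =O[cocompact ℂ] fun z => ‖z‖ ^ (-3 : ℝ) :=
    (isLittleO_exp_neg_mul_rpow_atTop hp (-3)).isBigO.comp_tendsto hnorm
  have h3 : (fun z : ℂ => ‖z‖ ^ (-3 : ℝ)) =O[cocompact ℂ] fun z => (1 + ‖z‖) ^ (-3 : ℝ) := by
    refine IsBigO.of_bound 8 ?_
    filter_upwards [hnorm.eventually_ge_atTop 1] with z hz
    have hz0 : 0 < ‖z‖ := by linarith
    rw [Real.norm_of_nonneg (by positivity), Real.norm_of_nonneg (by positivity),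
      Real.rpow_neg (by positivity), Real.rpow_neg (by positivity), ← div_eq_mul_inv,
      le_div_iff₀ (by positivity), inv_mul_le_iff₀ (by positivity)]
    calc (1 + ‖z‖) ^ (3 : ℝ) ≤ (2 * ‖z‖) ^ (3 : ℝ) := by gcongr; linarith
      _ = _ := by
          rw [Real.mul_rpow (by norm_num) hz0.le, mul_comm]
          norm_num
  exact (h1.trans h2).trans h3

/-! ### Consequences of the asymptotics of the moduli -/

section Moduli

variable {a b : ℝ} {lam : ℕ+ → ℝ}

theorem tendsto_succPNat_atTop : Tendsto Nat.succPNat atTop atTop :=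
  tendsto_atTop.2 fun n => by
    filter_upwards [eventually_ge_atTop (n : ℕ)] with i hi
    rw [← PNat.coe_le_coe, Nat.succPNat_coe]
    omega

namespace ModuliCondition

theorem tendsto_sub (h : ModuliCondition a b lam) :
    Tendsto (fun i : ℕ => lam i.succPNat ^ 2 - (((i : ℝ) + 1)
      + a * √((i : ℝ) + 1) * Real.log ((i : ℝ) + 1) ^ b)) atTop (𝓝 0) := by
  have := (isLittleO_one_iff ℝ).1 h.asymptotics
  simpa [Function.comp_def] using this.comp tendsto_succPNat_atTop

theorem tendsto_natCast_succ : Tendsto (fun i : ℕ => (i : ℝ) + 1) atTop atTop :=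
  tendsto_atTop_add_const_right _ _ tendsto_natCast_atTop_atTop

theorem tendsto_sq_div (h : ModuliCondition a b lam) :
    Tendsto (fun i : ℕ => lam i.succPNat ^ 2 / ((i : ℝ) + 1)) atTop (𝓝 1) := by
  have hl : Tendsto (fun x : ℝ => Real.log x ^ b / √x) atTop (𝓝 0) := by
    have := (isLittleO_log_rpow_rpow_atTop b (s := 1 / 2) (by norm_num)).tendsto_div_nhds_zero
    simpa [Real.sqrt_eq_rpow] using this
  have h1 := (h.tendsto_sub.div_atTop tendsto_natCast_succ)
  have h2 := ((hl.comp tendsto_natCast_succ).const_mul a).const_add 1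
  have h3 := h1.add h2
  simp only [mul_zero, add_zero, zero_add] at h3
  refine h3.congr fun i => ?_
  have hi : (0 : ℝ) < (i : ℝ) + 1 := by positivity
  have h5 : √((i : ℝ) + 1) / ((i : ℝ) + 1) = 1 / √((i : ℝ) + 1) := Real.sqrt_div_self'
  simp only [Function.comp_apply]
  have h6 : a * √((i : ℝ) + 1) * Real.log ((i : ℝ) + 1) ^ b / ((i : ℝ) + 1)
      = a * (Real.log ((i : ℝ) + 1) ^ b / √((i : ℝ) + 1)) := by
    calc _ = a * Real.log ((i : ℝ) + 1) ^ b * (√((i : ℝ) + 1) / ((i : ℝ) + 1)) := by ring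
      _ = _ := by rw [h5]; ring
  rw [sub_div, add_div, h6, div_self hi.ne']
  ring

/-- The factor a log^(b-1) tends to infinity, so it exceeds K + 1. The surplus √n log n absorbs the
o(1) error. -/
theorem eventually_ge (h : ModuliCondition a b lam) (ha : 0 < a) (hb : 1 < b) (K : ℝ) :
    ∀ᶠ i : ℕ in atTop, ((i : ℝ) + 1) + K * √((i : ℝ) + 1) * Real.log ((i : ℝ) + 1)
      ≤ lam i.succPNat ^ 2 := by
  have hl : Tendsto (fun x : ℝ => a * Real.log x ^ (b - 1)) atTop atTop :=
    ((tendsto_rpow_atTop (by linarith)).comp Real.tendsto_log_atTop).const_mul_atTop ha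
  filter_upwards [h.tendsto_sub.eventually (eventually_ge_nhds (show (-1 : ℝ) < 0 by norm_num)),
    tendsto_natCast_succ.eventually (hl.eventually_ge_atTop (K + 1)),
    tendsto_natCast_succ.eventually (Real.tendsto_log_atTop.eventually_ge_atTop 1)]
    with i h1 h2 h3
  have hs : 1 ≤ √((i : ℝ) + 1) := by
    rw [Real.one_le_sqrt]; linarith [Nat.cast_nonneg (α := ℝ) i]
  set L := Real.log ((i : ℝ) + 1)
  set s := √((i : ℝ) + 1)
  have hLb : L ^ b = L ^ (b - 1) * L := by
    rw [← Real.rpow_add_one (by linarith)]; congr 1; ring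
  have h4 : (K + 1) * (s * L) ≤ a * L ^ (b - 1) * (s * L) := by gcongr
  have h5 : 1 ≤ s * L := by nlinarith
  rw [hLb] at h1
  nlinarith

theorem exists_mul_succ_le (h : ModuliCondition a b lam) :
    ∃ c : ℝ, 0 < c ∧ ∀ i : ℕ, c * ((i : ℝ) + 1) ≤ lam i.succPNat ^ 2 := by
  obtain ⟨I, hI⟩ := eventually_atTop.1
    (h.tendsto_sq_div.eventually (eventually_ge_nhds (show (1 / 2 : ℝ) < 1 by norm_num)))
  -- The first entry serves i ≥ I, by the limit. The second serves the finitely many smaller i,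
  -- where only the lower bound 1 on the moduli is used.
  refine ⟨min (1 / 2) (1 / ((I : ℝ) + 1)), by positivity, fun i => ?_⟩
  have hi : (0 : ℝ) < (i : ℝ) + 1 := by positivity
  rcases le_or_gt I i with hIi | hIi
  · have := hI i hIi
    rw [le_div_iff₀ hi] at this
    exact (mul_le_mul_of_nonneg_right (min_le_left _ _) hi.le).trans this
  · have h1 : (1 : ℝ) ≤ lam i.succPNat ^ 2 := one_le_pow₀ (h.one_le _)
    refine (mul_le_mul_of_nonneg_right (min_le_right _ _) hi.le).trans (le_trans ?_ h1)
    rw [one_div, inv_mul_le_iff₀ (by positivity)]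
    have : (i : ℝ) ≤ I := by exact_mod_cast hIi.le
    linarith

theorem strictMono_succPNat (h : ModuliCondition a b lam) :
    StrictMono fun i : ℕ => lam i.succPNat :=
  h.strictMono.comp Nat.succPNat_strictMono

/-- Only the moduli enter, so the density claim holds for every choice of angles, not just almost
surely. Here n(t) is the first index at level t, and φ'(t) = t. -/
theorem isCriticalDensity (h : ModuliCondition a b lam) {z : ℕ+ → ℂ} (hz : ∀ n, ‖z n‖ = lam n) :
    IsCriticalDensity classicalWeight z := by
  have htop := tendsto_atTop_of_tendsto_sq_div (fun i => h.one_le i.succPNat) h.tendsto_sq_div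
  set r : ℕ → ℝ := fun i => lam i.succPNat with hr
  have hset : ∀ t : ℝ, {n : ℕ+ | ‖z n‖ < t}
      = Nat.succPNat '' (Finset.range (firstIndexGe r t) : Set ℕ) := fun t => by
    have hiff := fun i => apply_lt_iff_lt_firstIndexGe h.strictMono_succPNat htop (t := t) (i := i)
    ext n
    simp only [Set.mem_ofPred_eq, hz, Set.mem_image, Finset.coe_range, Set.mem_Iio]
    constructor
    · intro hn
      exact ⟨n.natPred, (hiff _).1 (by simpa using hn), PNat.succPNat_natPred n⟩
    · rintro ⟨i, hi, rfl⟩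
      exact (hiff i).2 hi
  have hcount : ∀ t : ℝ, countingFunction z t = firstIndexGe r t := fun t => by
    rw [countingFunction, hset, Set.ncard_image_of_injective _ Nat.succPNat_injective,
      Set.ncard_coe_finset, Finset.card_range]
  refine ⟨fun t => ?_, ?_⟩
  · rw [hset]
    exact (Finset.finite_toSet _).image _
  · refine (tendsto_firstIndexGe_div_sq h.strictMono_succPNat (fun i => h.one_le i.succPNat)
      h.tendsto_sq_div).congr fun t => ?_
    have hd : deriv classicalWeight t = t := by
      have : HasDerivAt (fun x : ℝ => x ^ 2 / 2) (((2 : ℕ) : ℝ) * t ^ (2 - 1) / 2) t :=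
        (hasDerivAt_pow 2 t).div_const 2
      change deriv (fun x : ℝ => x ^ 2 / 2) t = t
      rw [this.deriv]; norm_num
    rw [hcount, hd, sq]

end ModuliCondition

theorem exists_moduliCondition (ha : 0 < a) (hb : 0 < b) :
    ∃ lam : ℕ+ → ℝ, ModuliCondition a b lam := by
  set g : ℕ+ → ℝ := fun n => ((n : ℕ) : ℝ) + a * √((n : ℕ) : ℝ) * Real.log ((n : ℕ) : ℝ) ^ b
    with hg
  have hlog : ∀ n : ℕ+, 0 ≤ Real.log ((n : ℕ) : ℝ) := fun n => Real.log_natCast_nonneg _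
  have hg1 : ∀ n, 1 ≤ g n := fun n => by
    have h1 : (1 : ℝ) ≤ ((n : ℕ) : ℝ) := by exact_mod_cast n.pos
    have h2 : 0 ≤ a * √((n : ℕ) : ℝ) * Real.log ((n : ℕ) : ℝ) ^ b := by
      have := Real.rpow_nonneg (hlog n) b
      positivity
    simp only [hg]
    linarith
  -- The moduli are chosen with error term exactly zero.
  refine ⟨fun n => √(g n), fun m n hmn => ?_, fun n => ?_, ?_⟩
  · refine Real.sqrt_lt_sqrt (by linarith [hg1 m]) ?_
    have h1 : ((m : ℕ) : ℝ) < ((n : ℕ) : ℝ) := by exact_mod_cast hmn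
    have h0 : (0 : ℝ) < ((m : ℕ) : ℝ) := by exact_mod_cast m.pos
    have h2 : Real.log ((m : ℕ) : ℝ) ^ b ≤ Real.log ((n : ℕ) : ℝ) ^ b :=
      Real.rpow_le_rpow (hlog m) (Real.log_le_log h0 h1.le) hb.le
    have h3 := Real.rpow_nonneg (hlog m) b
    simp only [hg]
    refine add_lt_add_of_lt_of_le h1 ?_
    gcongr
  · exact Real.one_le_sqrt.2 (hg1 n)
  · have : (fun n : ℕ+ => √(g n) ^ 2 - (((n : ℕ) : ℝ)
        + a * √((n : ℕ) : ℝ) * Real.log ((n : ℕ) : ℝ) ^ b)) = fun _ => 0 := by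
      funext n
      rw [Real.sq_sqrt (by linarith [hg1 n])]
      exact sub_self _
    rw [this]
    exact isLittleO_zero _ _

end Moduli

/-! ### The main theorem -/

theorem theorem3 {Ω : Type*} [MeasurableSpace Ω] (P : Measure Ω) [IsProbabilityMeasure P]
    (θ : ℕ+ → Ω → ℝ) (hθ_meas : ∀ n, Measurable (θ n)) (hθ_indep : iIndepFun θ P)
    (hθ_unif : ∀ n, pdf.IsUniform (θ n) (Set.Icc 0 (2 * Real.pi)) P volume)
    (a b : ℝ) (ha : 0 < a) (hb : 3 / 2 < b) :
    (∀ lam : ℕ+ → ℝ, ModuliCondition a b lam →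
      (∀ᵐ ω ∂P, ∀ p : ℝ, 0 < p →
        IsZeroSet (FockSpace classicalWeight p) (randomization lam θ ω)) ∧
      (∀ ω, IsCriticalDensity classicalWeight (randomization lam θ ω))) ∧
    (∃ lam : ℕ+ → ℝ, ModuliCondition a b lam) := by
  refine ⟨fun lam h => ⟨?_, fun ω => ?_⟩, exists_moduliCondition ha (by linarith)⟩
  · obtain ⟨c, hc, hlow⟩ := h.exists_mul_succ_le
    have h1 : ∀ i : ℕ, 1 ≤ lam i.succPNat := fun i => h.one_le _
    have htop := tendsto_atTop_of_tendsto_sq_div h1 h.tendsto_sq_div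
    filter_upwards [ae_exists_norm_canonicalProduct_le (θ := fun i : ℕ => θ i.succPNat)
      (fun i => hθ_meas _) (hθ_indep.precomp Nat.succPNat_injective) (fun i => hθ_unif _)
      h.strictMono_succPNat h1 hc hlow h.tendsto_sq_div
      (h.eventually_ge ha (by linarith))] with ω ⟨C, R, hR⟩ p hp
    set z : ℕ → ℂ := fun i => (lam i.succPNat : ℂ) * circleMap 0 1 (θ i.succPNat ω) with hz
    have hzn : ∀ i, ‖z i‖ = lam i.succPNat := fun i => by
      simp only [hz]
      rw [norm_mul, Complex.norm_real, Real.norm_of_nonneg (by linarith [h1 i])]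
      simp
    have hz1 : ∀ i, 1 ≤ ‖z i‖ := fun i => (hzn i).symm ▸ h1 i
    have hzs : Summable fun i => (1 / ‖z i‖) ^ 3 := by
      simpa only [hzn] using summable_one_div_pow_three hc h1 hlow
    have hzt : Tendsto (fun i => ‖z i‖) atTop atTop := by simpa only [hzn] using htop
    refine ⟨canonicalProduct C z, mem_fockSpace_classicalWeight
      (differentiable_canonicalProduct hz1 hzs hzt) hR hp, fun h0 => ?_, fun w => ?_⟩
    · have := canonicalProduct_zero (C := C) (z := z)
      rw [h0] at this
      exact zero_ne_one this
    · rw [analyticOrderAt_canonicalProduct hz1 hzs hzt,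
        -- The shift i ↦ i + 1 is a bijection onto the positive integers, so it preserves
        -- multiplicities.
        ← Nat.succPNat_injective.encard_image]
      congr 1
      have hrand : ∀ i : ℕ, randomization lam θ ω i.succPNat = z i := fun i => by
        simp [randomization, hz, circleMap, mul_comm]
      ext n
      simp only [Set.mem_image, Set.mem_ofPred_eq]
      constructor
      · rintro ⟨i, hi, rfl⟩
        rw [hrand, hi]
      · intro hn
        exact ⟨n.natPred, by rw [← hrand, PNat.succPNat_natPred, hn], PNat.succPNat_natPred n⟩
  · refine h.isCriticalDensity fun n => ?_
    rw [randomization, norm_mul, Complex.norm_real,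
      Real.norm_of_nonneg (by linarith [h.one_le n]), mul_comm Complex.I,
      Complex.norm_exp_ofReal_mul_I, mul_one]
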